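/- Let $g:(\mathbb R^2,0)\to(\mathbb R^3,0)$ be a smooth ($C^\infty$) map-germ that is an immersion at $0$, and put $$\Sigma=\langle g_{uu},g_u\times g_v\rangle\langle g_{vv},g_u\times g_v\rangle-\langle g_{uv},g_u\times g_v\rangle^2,\qquad \boldsymbol n=\frac{g_u\times g_v}{\|g_u\times g_v\|},$$ so that $\{\Sigma=0\}$ is the parabolic set in the parameter space. Suppose that $0$ is a parabolic point, $\Sigma(0)=0$, but not an umbilic point (the second fundamental form at $0$ is not a multiple of the first), and that the parabolic set is non-singular at $0$, i.e. $d\Sigma(0)\neq 0$. Let $\gamma:(\mathbb R,0)\to(\mathbb R^2,0)$ be a smooth regular ($\gamma'(0)\ne0$) parameterization of the parabolic set near $0$, let $\mathcal L=g\circ\gamma$, and let $\boldsymbol b$, $\kappa$, $\tau$ be the unit binormal vector, the curvature and the torsion of $\mathcal L$. Assume $\kappa(0)\neq0$. Let $h_{\boldsymbol v}(u,v)=\langle g(u,v),\boldsymbol v\rangle$ be the height function along $\boldsymbol v=\pm\boldsymbol n(0)$ (either sign). A function-germ $h$ at $0\in\mathbb R^2$ has an $A_k$ singularity if $h-h(0)$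 is, after a smooth change of coordinates in the source fixing $0$, equal to $\pm y^2\pm x^{k+1}$ for some choice of signs; it has an $A_{\ge k}$ singularity if $h-h(0)$ is, after such a change, equal to $\pm y^2+\psi(x)$ with $\psi$ smooth and $\psi(x)=O(x^{k+1})$ (so $A_{\ge k}$ includes the case where $\psi$ is flat). Then: 1. $h_{\boldsymbol v}$ has an $A_2$ singularity at $0$ if and only if $\boldsymbol b(0)\neq\pm\boldsymbol n(0)$, i.e. $\boldsymbol b(0)$ is neither $\boldsymbol n(0)$ nor $-\boldsymbol n(0)$. 2. $h_{\boldsymbol v}$ has an $A_{\ge3}$ singularity at $0$ if and only if $\boldsymbol b(0)=\boldsymbol n(0)$ or $\boldsymbol b(0)=-\boldsymbol n(0)$. If $h_{\boldsymbol v}$ has an $A_{\ge3}$ singularity at $0$, then $\tau(0)=0$. 3. Assume that $h_{\boldsymbol v}$ has an $A_{\ge3}$ singularity at $0$. If $\tau'(0)\neq0$, then the singularity is of type $A_3$. If the singularity is of type $A_{\ge4}$, then $\tau'(0)=0$. -/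

import Mathlib

open scoped ContDiff Topology

namespace HeightSing

noncomputable section

/-- Euclidean three-space. -/
abbrev E3 : Type := EuclideanSpace ℝ (Fin 3)

/-- The cross product on Euclidean three-space. -/
def cross (a b : E3) : E3 := WithLp.toLp 2 (crossProduct a.ofLp b.ofLp)

/-- `f` is a smooth map-germ at `p`: it is `C^∞` on some neighbourhood of `p`. -/
def SmoothGermAt {E F : Type*} [NormedAddCommGroup E] [NormedSpace ℝ E]
    [NormedAddCommGroup F] [NormedSpace ℝ F] (f : E → F) (p : E) : Prop :=
  ∀ᶠ q in 𝓝 p, ContDiffAt ℝ ∞ f q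

/-! ### Singularities of function-germs of two variables at the origin -/

/-- `φ` is a germ of a diffeomorphism of the plane fixing the origin: it is smooth near the origin
and its differential there is invertible (inverse function theorem). -/
def IsDiffeoGerm (φ : ℝ × ℝ → ℝ × ℝ) : Prop :=
  SmoothGermAt φ 0 ∧ φ 0 = 0 ∧ Function.Bijective (fderiv ℝ φ 0)

/-- `f` has an `A_k` singularity at the origin (`k ≥ 1`): some change of coordinates in the source
turns the germ of `f - f 0` into `± y² ± x^(k+1)`. -/
def IsA (k : ℕ) (f : ℝ × ℝ → ℝ) : Prop :=
  ∃ φ : ℝ × ℝ → ℝ × ℝ, IsDiffeoGerm φ ∧ ∃ ε δ : ℝ, (ε = 1 ∨ ε = -1) ∧ (δ = 1 ∨ δ = -1) ∧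
    ∀ᶠ p in 𝓝 (0 : ℝ × ℝ), f (φ p) = f 0 + ε * p.2 ^ 2 + δ * p.1 ^ (k + 1)

/-- `f` has an `A_{≥ k}` singularity at the origin (`k ≥ 1`): some change of coordinates in the
source turns the germ of `f - f 0` into `± y² + ψ(x)` with `ψ` smooth and of order at least `k + 1`.
Thus `f` is of type `A_j` with `j ≥ k` when `ψ` has finite order `j + 1`; the case of a flat `ψ`
(sometimes called `A_∞`) is included. -/
def IsAGe (k : ℕ) (f : ℝ × ℝ → ℝ) : Prop :=
  ∃ φ : ℝ × ℝ → ℝ × ℝ, IsDiffeoGerm φ ∧ ∃ ε : ℝ, (ε = 1 ∨ ε = -1) ∧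
    ∃ ψ : ℝ → ℝ, SmoothGermAt ψ 0 ∧ (ψ =O[𝓝 0] fun x : ℝ => x ^ (k + 1)) ∧
      ∀ᶠ p in 𝓝 (0 : ℝ × ℝ), f (φ p) = f 0 + ε * p.2 ^ 2 + ψ p.1

/-! ### Parameterized surfaces -/

section Partial

variable {F : Type*} [NormedAddCommGroup F] [NormedSpace ℝ F]

/-- The partial derivative with respect to the first variable `u`. -/
def du (f : ℝ × ℝ → F) (p : ℝ × ℝ) : F := fderiv ℝ f p (1, 0)

/-- The partial derivative with respect to the second variable `v`. -/
def dv (f : ℝ × ℝ → F) (p : ℝ × ℝ) : F := fderiv ℝ f p (0, 1)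

end Partial

/-- `g_u × g_v`. -/
def normalField (g : ℝ × ℝ → E3) (p : ℝ × ℝ) : E3 := cross (du g p) (dv g p)

/-- The unit normal `n = g_u × g_v / ‖g_u × g_v‖`. -/
def unitNormal (g : ℝ × ℝ → E3) (p : ℝ × ℝ) : E3 := ‖normalField g p‖⁻¹ • normalField g p

/-- The function
`⟨g_uu, g_u × g_v⟩ ⟨g_vv, g_u × g_v⟩ - ⟨g_uv, g_u × g_v⟩²`, whose zero set is the parabolic set in
the parameter space. -/
def parabolicFn (g : ℝ × ℝ → E3) (p : ℝ × ℝ) : ℝ :=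
  inner ℝ (du (du g) p) (normalField g p) * inner ℝ (dv (dv g) p) (normalField g p)
    - inner ℝ (dv (du g) p) (normalField g p) ^ 2

/-- `p` is an umbilic of `g`: at `p` the second fundamental form is a (possibly zero) multiple of
the first. -/
def IsUmbilic (g : ℝ × ℝ → E3) (p : ℝ × ℝ) : Prop :=
  ∃ c : ℝ,
    inner ℝ (du (du g) p) (unitNormal g p) = c * inner ℝ (du g p) (du g p) ∧
    inner ℝ (dv (du g) p) (unitNormal g p) = c * inner ℝ (du g p) (dv g p) ∧
    inner ℝ (dv (dv g) p) (unitNormal g p) = c * inner ℝ (dv g p) (dv g p)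

/-- The height function `h_w = ⟨g, w⟩`. -/
def height (g : ℝ × ℝ → E3) (w : E3) (p : ℝ × ℝ) : ℝ := inner ℝ (g p) w

/-! ### Space curves (arbitrary regular parameter) -/

/-- The curvature `‖c' × c''‖ / ‖c'‖³`. -/
def curvature (c : ℝ → E3) (t : ℝ) : ℝ :=
  ‖cross (deriv c t) (iteratedDeriv 2 c t)‖ / ‖deriv c t‖ ^ 3

/-- The unit binormal vector `c' × c'' / ‖c' × c''‖`. -/
def binormal (c : ℝ → E3) (t : ℝ) : E3 :=
  ‖cross (deriv c t) (iteratedDeriv 2 c t)‖⁻¹ • cross (deriv c t) (iteratedDeriv 2 c t)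

/-- The torsion `det(c', c'', c''') / ‖c' × c''‖²`. -/
def torsion (c : ℝ → E3) (t : ℝ) : ℝ :=
  inner ℝ (cross (deriv c t) (iteratedDeriv 2 c t)) (iteratedDeriv 3 c t)
    / ‖cross (deriv c t) (iteratedDeriv 2 c t)‖ ^ 2

end

end HeightSing

namespace HeightSing

open Filter Asymptotics

/-! ### Smooth germs -/

section Germ

variable {E F G : Type*} [NormedAddCommGroup E] [NormedSpace ℝ E]
  [NormedAddCommGroup F] [NormedSpace ℝ F] [NormedAddCommGroup G] [NormedSpace ℝ G]

/-! At a non-umbilic point the Hessian of the height function `h` along the normal `w` is non-zero,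
so the splitting lemma gives coordinates with `h = ±y² + ψ(x)`. The type of the singularity is then
read off from the order of `ψ`, and the task is to compare this order with the contact of the
parabolic curve with the tangent plane.

In such coordinates the parabolic function `Σ` satisfies, along the `x`-axis, `A Σ = B ψ'' + R ψ'`
with `A(0), B(0) ≠ 0` (`IsSplitSurface.exists_parabolicFn_eq`). Parabolicity therefore gives `ψ''(0)
= 0`, so `ψ = O(x³)` always. One more derivative shows that `ψ = O(x⁴)` exactly when `Σ_u(0) = 0`,
that is, when the parabolic curve is tangent to the `x`-axis, the kernel of the Hessian.

If `ψ = O(x^(k+4))`, then `Σ(x, 0) = O(x^(k+2))`. Since `Σ_v(0) ≠ 0`, the curve satisfies `y =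
O(t^(k+2))`, and `h = ±y² + ψ(x)` is `O(t^(k+4))` along it. Conversely, if `h` is `O(t³)` along the
curve, then so is `y²`, hence `y'(0) = 0`, the curve is tangent to the axis and `ψ = O(x⁴)`.
`IsSplitting.contact` collects these facts for an arbitrary splitting, so no uniqueness of the
normal form is needed.

It remains to read contact on the space curve: order 3 means that the binormal is `±w`, order 4
gives `τ(0) = 0`, and order 5 gives `τ'(0) = 0`. -/

theorem SmoothGermAt.contDiffAt {f : E → F} {p : E} (h : SmoothGermAt f p) :
    ContDiffAt ℝ ∞ f p := Eventually.self_of_nhds h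

theorem SmoothGermAt.differentiableAt {f : E → F} {p : E} (h : SmoothGermAt f p) :
    DifferentiableAt ℝ f p := h.contDiffAt.differentiableAt (by simp)

theorem SmoothGermAt.continuousAt {f : E → F} {p : E} (h : SmoothGermAt f p) :
    ContinuousAt f p := h.contDiffAt.continuousAt

theorem SmoothGermAt.eventually_differentiableAt {f : E → F} {p : E} (h : SmoothGermAt f p) :
    ∀ᶠ q in 𝓝 p, DifferentiableAt ℝ f q :=
  Eventually.mono h fun _ hq => hq.differentiableAt (by simp)

theorem _root_.ContDiff.smoothGermAt {f : E → F} (h : ContDiff ℝ ∞ f) (p : E) :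
    SmoothGermAt f p := Eventually.of_forall fun _ => h.contDiffAt

theorem SmoothGermAt.congr {f g : E → F} {p : E} (h : SmoothGermAt f p) (hfg : g =ᶠ[𝓝 p] f) :
    SmoothGermAt g p := by
  filter_upwards [h, hfg.eventuallyEq_nhds] with q hq hq'
  exact hq.congr_of_eventuallyEq hq'

theorem SmoothGermAt.comp {f : F → G} {g : E → F} {p : E} (hf : SmoothGermAt f (g p))
    (hg : SmoothGermAt g p) : SmoothGermAt (fun x => f (g x)) p := by
  filter_upwards [hg, hg.continuousAt.eventually hf] with q h1 h2
  exact h2.comp q h1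

theorem SmoothGermAt.comp_of_eq {f : F → G} {g : E → F} {p : E} {q : F} (hf : SmoothGermAt f q)
    (hg : SmoothGermAt g p) (h : g p = q) : SmoothGermAt (fun x => f (g x)) p := by
  subst h; exact hf.comp hg

theorem smoothGermAt_const (c : F) (p : E) : SmoothGermAt (fun _ => c) p :=
  contDiff_const.smoothGermAt p

theorem SmoothGermAt.add {f g : E → F} {p : E} (hf : SmoothGermAt f p) (hg : SmoothGermAt g p) :
    SmoothGermAt (fun x => f x + g x) p := by
  filter_upwards [hf, hg] with q h1 h2 using h1.add h2

theorem SmoothGermAt.sub {f g : E → F} {p : E} (hf : SmoothGermAt f p) (hg : SmoothGermAt g p) :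
    SmoothGermAt (fun x => f x - g x) p := by
  filter_upwards [hf, hg] with q h1 h2 using h1.sub h2

theorem SmoothGermAt.mul {f g : E → ℝ} {p : E} (hf : SmoothGermAt f p) (hg : SmoothGermAt g p) :
    SmoothGermAt (fun x => f x * g x) p := by
  filter_upwards [hf, hg] with q h1 h2 using h1.mul h2

theorem SmoothGermAt.pow {f : E → ℝ} {p : E} (hf : SmoothGermAt f p) (n : ℕ) :
    SmoothGermAt (fun x => f x ^ n) p := by
  filter_upwards [hf] with q h1 using h1.pow n

theorem SmoothGermAt.smooth_inner {f g : E → E3} {p : E} (hf : SmoothGermAt f p)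
    (hg : SmoothGermAt g p) : SmoothGermAt (fun x => inner ℝ (f x) (g x)) p := by
  filter_upwards [hf, hg] with q h1 h2 using h1.inner ℝ h2

theorem SmoothGermAt.prodMk {f : E → F} {g : E → G} {p : E} (hf : SmoothGermAt f p)
    (hg : SmoothGermAt g p) : SmoothGermAt (fun x => (f x, g x)) p := by
  filter_upwards [hf, hg] with q h1 h2 using h1.prodMk h2

theorem SmoothGermAt.fst {f : E → F × G} {p : E} (hf : SmoothGermAt f p) :
    SmoothGermAt (fun x => (f x).1) p := (contDiff_fst.smoothGermAt _).comp hf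

theorem SmoothGermAt.snd {f : E → F × G} {p : E} (hf : SmoothGermAt f p) :
    SmoothGermAt (fun x => (f x).2) p := (contDiff_snd.smoothGermAt _).comp hf

theorem SmoothGermAt.smooth_fderiv {f : E → F} {p : E} (hf : SmoothGermAt f p) :
    SmoothGermAt (fderiv ℝ f) p := by
  filter_upwards [hf] with q h1 using h1.fderiv_right (by simp)

theorem SmoothGermAt.fderiv_apply {f : E → F} {p : E} (hf : SmoothGermAt f p) (v : E) :
    SmoothGermAt (fun x => fderiv ℝ f x v) p := by
  filter_upwards [hf.smooth_fderiv] with q h1 using h1.clm_apply contDiffAt_const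

theorem SmoothGermAt.smooth_du {f : ℝ × ℝ → F} {p : ℝ × ℝ} (hf : SmoothGermAt f p) :
    SmoothGermAt (du f) p := hf.fderiv_apply _

theorem SmoothGermAt.smooth_dv {f : ℝ × ℝ → F} {p : ℝ × ℝ} (hf : SmoothGermAt f p) :
    SmoothGermAt (dv f) p := hf.fderiv_apply _

theorem SmoothGermAt.smooth_deriv {f : ℝ → F} {p : ℝ} (hf : SmoothGermAt f p) :
    SmoothGermAt (deriv f) p :=
  (hf.fderiv_apply 1).congr (Eventually.of_forall fun _ => by simp)

theorem SmoothGermAt.smooth_iteratedDeriv {f : ℝ → F} {p : ℝ} (hf : SmoothGermAt f p) (n : ℕ) :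
    SmoothGermAt (iteratedDeriv n f) p := by
  induction n with
  | zero => simpa using hf
  | succ n ih => rw [iteratedDeriv_succ]; exact ih.smooth_deriv

/-- Every smooth germ is the germ of a globally smooth map. -/
theorem SmoothGermAt.exists_contDiff [FiniteDimensional ℝ E] {f : E → F} {p : E}
    (hf : SmoothGermAt f p) : ∃ f' : E → F, ContDiff ℝ ∞ f' ∧ f' =ᶠ[𝓝 p] f := by
  obtain ⟨r, hr, hball⟩ := Metric.eventually_nhds_iff_ball.1 hf
  -- The outer radius is strictly below `r`, so each point outside the ball of radius `r` has a
  -- whole neighbourhood on which the bump vanishes.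
  let χ : ContDiffBump p := ⟨r / 4, r / 2, by positivity, by linarith⟩
  refine ⟨fun x => χ x • f x, ?_, ?_⟩
  · rw [contDiff_iff_contDiffAt]
    intro x
    by_cases hx : x ∈ Metric.ball p r
    · exact χ.contDiff.contDiffAt.smul (hball x hx)
    · have hx' : x ∈ (Metric.closedBall p (r / 2))ᶜ := by
        simp only [Metric.mem_ball, Set.mem_compl_iff, Metric.mem_closedBall] at *
        linarith
      have : (fun x => χ x • f x) =ᶠ[𝓝 x] fun _ => 0 := by
        filter_upwards [Metric.isClosed_closedBall.isOpen_compl.mem_nhds hx'] with y hy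
        have : χ y = 0 := χ.zero_of_le_dist (by
          simp only [Set.mem_compl_iff, Metric.mem_closedBall] at hy
          exact (not_le.1 hy).le)
        simp [this]
      exact contDiffAt_const.congr_of_eventuallyEq this
  · filter_upwards [χ.eventuallyEq_one] with x hx
    simp [hx]

end Germ

/-! ### Hadamard's lemma -/

/-- Differentiation under the integral sign, iterated. The target `E` is quantified inside the
induction because the derivative is an integral of the same kind with values in `H →L[ℝ] E`. -/
theorem contDiff_intervalIntegral_nat {H : Type} [NormedAddCommGroup H] [NormedSpace ℝ H]
    [FiniteDimensional ℝ H] (n : ℕ) : ∀ {E : Type} [NormedAddCommGroup E] [NormedSpace ℝ E]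
    [CompleteSpace E]
    {F : H × ℝ → E} (_ : ContDiff ℝ n F), ContDiff ℝ n fun x => ∫ t in (0 : ℝ)..1, F (x, t) := by
  induction n with
  | zero =>
    intro E _ _ _ F hF
    refine contDiff_zero.2 ?_
    exact intervalIntegral.continuous_parametric_intervalIntegral_of_continuous'
      (f := fun x t => F (x, t)) hF.continuous 0 1
  | succ n ih =>
    intro E _ _ _ F hF
    let F' : H × ℝ → H →L[ℝ] E := fun p => (fderiv ℝ F p).comp (ContinuousLinearMap.inl ℝ H ℝ)
    have hF'c : ContDiff ℝ n F' := (hF.fderiv_right (by simp)).clm_comp contDiff_const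
    have hder : ∀ x : H, HasFDerivAt (fun x => ∫ t in (0 : ℝ)..1, F (x, t))
        (∫ t in (0 : ℝ)..1, F' (x, t)) x := by
      intro x
      obtain ⟨K, hK⟩ : ∃ K, ∀ p ∈ Metric.closedBall x 1 ×ˢ Set.Icc (0 : ℝ) 1, ‖F' p‖ ≤ K :=
        ((isCompact_closedBall x 1).prod isCompact_Icc).exists_bound_of_continuousOn
          hF'c.continuous.continuousOn
      refine intervalIntegral.hasFDerivAt_integral_of_dominated_of_fderiv_le
        (s := Metric.closedBall x 1) (bound := fun _ => K) (F := fun x t => F (x, t))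
        (F' := fun x t => F' (x, t))
        (Metric.closedBall_mem_nhds x one_pos) ?_ ?_ ?_ ?_ ?_ ?_
      · refine Eventually.of_forall fun y => ?_
        exact (hF.continuous.comp (by fun_prop : Continuous fun t : ℝ => (y, t))).aestronglyMeasurable
      · exact (hF.continuous.comp
          (by fun_prop : Continuous fun t : ℝ => (x, t))).intervalIntegrable _ _
      · exact (hF'c.continuous.comp
          (by fun_prop : Continuous fun t : ℝ => (x, t))).aestronglyMeasurable
      · refine Eventually.of_forall fun t ht y hy => hK _ ⟨hy, ?_⟩
        rw [Set.uIoc_of_le zero_le_one] at ht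
        exact ⟨ht.1.le, ht.2⟩
      · exact intervalIntegrable_const
      · refine Eventually.of_forall fun t _ y _ => ?_
        have h1 : HasFDerivAt F (fderiv ℝ F (y, t)) (y, t) :=
          (hF.differentiable (by simp) (y, t)).hasFDerivAt
        exact h1.comp y (hasFDerivAt_prodMk_left y t)
    have : ContDiff ℝ ((n : ℕ∞ω) + 1) fun x => ∫ t in (0 : ℝ)..1, F (x, t) := by
      rw [contDiff_succ_iff_fderiv]
      refine ⟨fun x => (hder x).differentiableAt, by simp, ?_⟩
      have : fderiv ℝ (fun x => ∫ t in (0 : ℝ)..1, F (x, t)) =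
          fun x => ∫ t in (0 : ℝ)..1, F' (x, t) := funext fun x => (hder x).fderiv
      rw [this]
      exact ih hF'c
    exact_mod_cast this

/-- An integral over `[0, 1]` of a smooth function depends smoothly on the parameters. -/
theorem contDiff_intervalIntegral {H E : Type} [NormedAddCommGroup H] [NormedSpace ℝ H]
    [FiniteDimensional ℝ H] [NormedAddCommGroup E] [NormedSpace ℝ E] [CompleteSpace E]
    {F : H × ℝ → E} (hF : ContDiff ℝ ∞ F) :
    ContDiff ℝ ∞ fun x => ∫ t in (0 : ℝ)..1, F (x, t) :=
  contDiff_infty.2 fun n => contDiff_intervalIntegral_nat n (hF.of_le (by exact_mod_cast le_top))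

/-- Hadamard's lemma: a smooth germ vanishing on the first axis is divisible by the second
coordinate. -/
theorem SmoothGermAt.exists_eq_snd_mul {f : ℝ × ℝ → ℝ} (hf : SmoothGermAt f 0)
    (h0 : ∀ᶠ x in 𝓝 (0 : ℝ), f (x, 0) = 0) :
    ∃ r : ℝ × ℝ → ℝ, SmoothGermAt r 0 ∧ ∀ᶠ p in 𝓝 (0 : ℝ × ℝ), f p = p.2 * r p := by
  obtain ⟨k, hk, hkf⟩ := hf.exists_contDiff
  -- The quotient is `∫₀¹ k_v(x, t y) dt`. The global extension `k` makes the integrand smooth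
  -- everywhere, so the parametric integral result applies directly.
  let D : (ℝ × ℝ) × ℝ → ℝ := fun q => fderiv ℝ k (q.1.1, q.2 * q.1.2) (0, 1)
  have hD : ContDiff ℝ ∞ D :=
    ((hk.fderiv_right (m := ∞) (by simp)).comp (by fun_prop :
      ContDiff ℝ ∞ fun q : (ℝ × ℝ) × ℝ => (q.1.1, q.2 * q.1.2))).clm_apply contDiff_const
  refine ⟨_, (contDiff_intervalIntegral hD).smoothGermAt 0, ?_⟩
  have hx : Tendsto (fun p : ℝ × ℝ => p.1) (𝓝 0) (𝓝 0) :=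
    (continuous_fst.tendsto (0 : ℝ × ℝ))
  have hx0 : Tendsto (fun p : ℝ × ℝ => (p.1, (0 : ℝ))) (𝓝 0) (𝓝 0) :=
    ((by fun_prop : Continuous fun p : ℝ × ℝ => (p.1, (0 : ℝ))).tendsto' 0 0 rfl)
  filter_upwards [hkf, hx.eventually h0, hx0.eventually hkf] with p h1 h2 h3
  have hderiv : ∀ t ∈ Set.uIcc (0 : ℝ) 1,
      HasDerivAt (fun t : ℝ => k (p.1, t * p.2)) (p.2 * D (p, t)) t := by
    intro t _
    have hk' : HasFDerivAt k (fderiv ℝ k (p.1, t * p.2)) (p.1, t * p.2) :=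
      (hk.differentiable (by simp) _).hasFDerivAt
    have hl : HasDerivAt (fun t : ℝ => (p.1, t * p.2)) (0, p.2) t := by
      simpa using (hasDerivAt_const t p.1).prodMk ((hasDerivAt_id t).mul_const p.2)
    have := hk'.comp_hasDerivAt t hl
    have e : ((0 : ℝ), p.2) = p.2 • ((0 : ℝ), (1 : ℝ)) := by simp
    rw [e, map_smul] at this
    exact this
  have hint := intervalIntegral.integral_eq_sub_of_hasDerivAt hderiv
    ((by
      have : Continuous fun t : ℝ => D (p, t) := hD.continuous.comp (by fun_prop)
      exact (continuous_const.mul this).intervalIntegrable _ _))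
  rw [intervalIntegral.integral_const_mul] at hint
  rw [hint, ← h1]
  simp [h3, h2]

/-- Hadamard's lemma in one variable. -/
theorem SmoothGermAt.exists_eq_mul {f : ℝ → ℝ} (hf : SmoothGermAt f 0) (h0 : f 0 = 0) :
    ∃ r : ℝ → ℝ, SmoothGermAt r 0 ∧ ∀ᶠ x in 𝓝 (0 : ℝ), f x = x * r x := by
  have hs : SmoothGermAt (fun p : ℝ × ℝ => f p.2) 0 :=
    hf.comp_of_eq (contDiff_snd.smoothGermAt (0 : ℝ × ℝ)) rfl
  obtain ⟨r, hr, hfr⟩ := hs.exists_eq_snd_mul (Eventually.of_forall fun _ => h0)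
  have hc : ContDiff ℝ ∞ fun x : ℝ => ((0 : ℝ), x) := by fun_prop
  have ht : Tendsto (fun x : ℝ => ((0 : ℝ), x)) (𝓝 0) (𝓝 0) := hc.continuous.tendsto' 0 0 rfl
  exact ⟨fun x => r (0, x), hr.comp_of_eq (hc.smoothGermAt 0) rfl, ht.eventually hfr⟩

/-- A smooth germ of order at least `n` is divisible by `x ^ n`. -/
theorem SmoothGermAt.exists_eq_pow_mul {f : ℝ → ℝ} (hf : SmoothGermAt f 0) (n : ℕ)
    (h : f =O[𝓝 0] fun x : ℝ => x ^ n) :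
    ∃ r : ℝ → ℝ, SmoothGermAt r 0 ∧ ∀ᶠ x in 𝓝 (0 : ℝ), f x = x ^ n * r x := by
  induction n with
  | zero => exact ⟨f, hf, by simp⟩
  | succ n ih =>
    obtain ⟨u, hu, hfu⟩ := ih (h.trans (IsBigO.of_bound 1 (by
      filter_upwards [Metric.ball_mem_nhds (0 : ℝ) one_pos] with x hx
      simp only [Metric.mem_ball, dist_zero_right] at hx
      rw [pow_succ, norm_mul, one_mul]
      exact mul_le_of_le_one_right (norm_nonneg _) hx.le)))
    -- Cancelling `x ^ n` off the origin leaves `u = O(x)`, so `u` tends to `0` there; one more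
    -- factor `x` can then be extracted.
    have hu0 : u 0 = 0 := by
      have h1 : Tendsto u (𝓝[≠] 0) (𝓝 (u 0)) := hu.continuousAt.tendsto.mono_left nhdsWithin_le_nhds
      have h2 : u =O[𝓝[≠] (0 : ℝ)] fun x : ℝ => x := by
        obtain ⟨C, hC⟩ := h.bound
        refine IsBigO.of_bound C ?_
        filter_upwards [nhdsWithin_le_nhds hC, nhdsWithin_le_nhds hfu, self_mem_nhdsWithin]
          with x hx1 hx2 hx3
        rw [hx2, norm_mul, pow_succ, norm_mul, mul_left_comm] at hx1
        exact le_of_mul_le_mul_left hx1 (norm_pos_iff.2 (pow_ne_zero _ hx3))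
      have h3 : Tendsto u (𝓝[≠] (0 : ℝ)) (𝓝 0) :=
        h2.trans_tendsto (tendsto_id.mono_left nhdsWithin_le_nhds)
      exact tendsto_nhds_unique h1 h3
    obtain ⟨v, hv, huv⟩ := hu.exists_eq_mul hu0
    refine ⟨v, hv, ?_⟩
    filter_upwards [hfu, huv] with x h1 h2
    rw [h1, h2, pow_succ, mul_assoc]

/-- Differentiation lowers the order of vanishing by at most one. -/
theorem SmoothGermAt.deriv_isBigO {f : ℝ → ℝ} (hf : SmoothGermAt f 0) {n : ℕ}
    (h : f =O[𝓝 0] fun x : ℝ => x ^ (n + 1)) : deriv f =O[𝓝 0] fun x : ℝ => x ^ n := by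
  obtain ⟨u, hu, hfu⟩ := hf.exists_eq_pow_mul _ h
  have hd : ∀ᶠ x in 𝓝 (0 : ℝ),
      deriv f x = x ^ n * ((n + 1 : ℕ) * u x + x * deriv u x) := by
    filter_upwards [hfu.eventually_nhds, hu.eventually_differentiableAt] with x h1 h2
    rw [EventuallyEq.deriv_eq h1]
    have := ((hasDerivAt_pow (n + 1) x).mul h2.hasDerivAt).deriv
    simp only [Nat.add_sub_cancel] at this
    refine Eq.trans ?_ (this.trans (by ring))
    rfl
  have hc : ContinuousAt (fun x => ((n + 1 : ℕ) : ℝ) * u x + x * deriv u x) 0 :=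
    (hu.continuousAt.const_mul _).add (continuousAt_id.mul hu.smooth_deriv.continuousAt)
  have h1 : (fun x : ℝ => x ^ n * ((n + 1 : ℕ) * u x + x * deriv u x))
      =O[𝓝 0] fun x : ℝ => x ^ n * 1 :=
    (isBigO_refl _ _).mul (hc.tendsto.isBigO_one ℝ)
  simpa using h1.congr' (hd.mono fun x hx => hx.symm) EventuallyEq.rfl

/-- A smooth germ whose derivatives of order less than `n` vanish at `0` is `O(x ^ n)`, and
conversely. -/
theorem SmoothGermAt.isBigO_pow_iff {n : ℕ} : ∀ {f : ℝ → ℝ}, SmoothGermAt f 0 →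
    ((f =O[𝓝 0] fun x : ℝ => x ^ n) ↔ ∀ i < n, iteratedDeriv i f 0 = 0) := by
  induction n with
  | zero =>
    intro f hf
    simpa using hf.continuousAt.tendsto.isBigO_one ℝ
  | succ n ih =>
    intro f hf
    constructor
    · intro h i hi
      cases i with
      | zero =>
        obtain ⟨u, _, hfu⟩ := hf.exists_eq_pow_mul _ h
        simpa using hfu.self_of_nhds
      | succ i =>
        rw [iteratedDeriv_succ']
        exact (ih hf.smooth_deriv).1 (hf.deriv_isBigO h) i (by omega)
    · intro h
      have h0 : f 0 = 0 := by simpa using h 0 (by omega)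
      obtain ⟨u, hu, hfu⟩ := hf.exists_eq_pow_mul n
        ((ih hf).2 fun i hi => h i (by omega))
      have hO := (ih hf.smooth_deriv).2 fun i hi => by
        rw [← iteratedDeriv_succ']; exact h (i + 1) (by omega)
      obtain ⟨C, hC0, hC⟩ := hO.exists_pos
      rw [isBigOWith_iff] at hC
      obtain ⟨r, hr, hball⟩ := Metric.eventually_nhds_iff_ball.1
        (hC.and hf.eventually_differentiableAt)
      refine IsBigO.of_bound C ?_
      filter_upwards [Metric.ball_mem_nhds (0 : ℝ) hr] with x hx
      have hseg : ∀ y ∈ Set.uIcc 0 x, ‖y‖ ≤ ‖x‖ := fun y hy => by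
        have := Set.abs_sub_left_of_mem_uIcc hy
        simpa using this
      -- Mean value inequality on the segment from `0` to `x`, where `|f'| ≤ C |x|^n`.
      have := (convex_uIcc (0 : ℝ) x).norm_image_sub_le_of_norm_deriv_le
        (f := f) (C := C * ‖x ^ n‖) (fun y hy => (hball y (by
          have := hseg y hy
          simp only [Metric.mem_ball, dist_zero_right] at hx ⊢
          linarith)).2) (fun y hy => by
          have h1 := hseg y hy
          have hy' : y ∈ Metric.ball (0 : ℝ) r := by
            simp only [Metric.mem_ball, dist_zero_right] at hx ⊢
            linarith
          refine (hball y hy').1.trans ?_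
          rw [norm_pow, norm_pow]
          gcongr) Set.left_mem_uIcc Set.right_mem_uIcc
      rw [h0, sub_zero, sub_zero, mul_assoc, ← norm_mul, ← pow_succ] at this
      exact this

/-! ### Diffeomorphism germs of the plane -/

section Partial

variable {F : Type*} [NormedAddCommGroup F] [NormedSpace ℝ F]

theorem clm_apply_eq_add (A : ℝ × ℝ →L[ℝ] F) (q : ℝ × ℝ) :
    A q = q.1 • A (1, 0) + q.2 • A (0, 1) := by
  rw [← map_smul, ← map_smul, ← map_add]
  simp

theorem fderiv_apply_eq (f : ℝ × ℝ → F) (p q : ℝ × ℝ) :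
    fderiv ℝ f p q = q.1 • du f p + q.2 • dv f p := clm_apply_eq_add _ q

theorem hasDerivAt_du {f : ℝ × ℝ → F} {p : ℝ × ℝ} (hf : DifferentiableAt ℝ f p) :
    HasDerivAt (fun x => f (x, p.2)) (du f p) p.1 := by
  have h : HasDerivAt (fun x : ℝ => (x, p.2)) ((1 : ℝ), (0 : ℝ)) p.1 :=
    (hasDerivAt_id _).prodMk (hasDerivAt_const _ _)
  have hf' : HasFDerivAt f (fderiv ℝ f p) (p.1, p.2) := hf.hasFDerivAt
  exact hf'.comp_hasDerivAt p.1 h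

theorem hasDerivAt_dv {f : ℝ × ℝ → F} {p : ℝ × ℝ} (hf : DifferentiableAt ℝ f p) :
    HasDerivAt (fun y => f (p.1, y)) (dv f p) p.2 := by
  have h : HasDerivAt (fun y : ℝ => (p.1, y)) ((0 : ℝ), (1 : ℝ)) p.2 :=
    (hasDerivAt_const _ _).prodMk (hasDerivAt_id _)
  have hf' : HasFDerivAt f (fderiv ℝ f p) (p.1, p.2) := hf.hasFDerivAt
  exact hf'.comp_hasDerivAt p.2 h

theorem du_comp {f : ℝ × ℝ → F} {φ : ℝ × ℝ → ℝ × ℝ} {p : ℝ × ℝ}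
    (hf : DifferentiableAt ℝ f (φ p)) (hφ : DifferentiableAt ℝ φ p) :
    du (fun q => f (φ q)) p = (du φ p).1 • du f (φ p) + (du φ p).2 • dv f (φ p) := by
  rw [du, fderiv_fun_comp p hf hφ, ContinuousLinearMap.comp_apply, fderiv_apply_eq]
  rfl

theorem dv_comp {f : ℝ × ℝ → F} {φ : ℝ × ℝ → ℝ × ℝ} {p : ℝ × ℝ}
    (hf : DifferentiableAt ℝ f (φ p)) (hφ : DifferentiableAt ℝ φ p) :
    dv (fun q => f (φ q)) p = (dv φ p).1 • du f (φ p) + (dv φ p).2 • dv f (φ p) := by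
  rw [dv, fderiv_fun_comp p hf hφ, ContinuousLinearMap.comp_apply, fderiv_apply_eq]
  rfl

theorem du_congr {f g : ℝ × ℝ → F} {p : ℝ × ℝ} (h : f =ᶠ[𝓝 p] g) : du f p = du g p := by
  rw [du, du, h.fderiv_eq]

theorem dv_congr {f g : ℝ × ℝ → F} {p : ℝ × ℝ} (h : f =ᶠ[𝓝 p] g) : dv f p = dv g p := by
  rw [dv, dv, h.fderiv_eq]

/-- Mixed partial derivatives commute. -/
theorem du_dv_comm {f : ℝ × ℝ → F} {p : ℝ × ℝ} (hf : ContDiffAt ℝ ∞ f p) :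
    du (dv f) p = dv (du f) p := by
  have hs : IsSymmSndFDerivAt ℝ f p := hf.isSymmSndFDerivAt (by
    rw [minSmoothness_of_isRCLikeNormedField]; exact WithTop.coe_le_coe.2 (le_top (a := (2 : ℕ∞))))
  have hd : DifferentiableAt ℝ (fderiv ℝ f) p :=
    (hf.fderiv_right (m := ∞) (by simp)).differentiableAt (by simp)
  have h1 : ∀ v w : ℝ × ℝ, fderiv ℝ (fun q => fderiv ℝ f q v) p w = fderiv ℝ (fderiv ℝ f) p w v := by
    intro v w
    rw [fderiv_clm_apply hd (differentiableAt_const v)]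
    simp
  change fderiv ℝ (fun q => fderiv ℝ f q (0, 1)) p (1, 0) =
    fderiv ℝ (fun q => fderiv ℝ f q (1, 0)) p (0, 1)
  rw [h1, h1]
  exact hs.eq _ _

end Partial

/-- The Jacobian determinant of a map of the plane. -/
noncomputable def jac (φ : ℝ × ℝ → ℝ × ℝ) (p : ℝ × ℝ) : ℝ :=
  (du φ p).1 * (dv φ p).2 - (dv φ p).1 * (du φ p).2

theorem SmoothGermAt.smooth_jac {φ : ℝ × ℝ → ℝ × ℝ} {p : ℝ × ℝ} (h : SmoothGermAt φ p) :
    SmoothGermAt (jac φ) p :=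
  (h.smooth_du.fst.mul h.smooth_dv.snd).sub (h.smooth_dv.fst.mul h.smooth_du.snd)

theorem clm_bijective_of_injective {A : ℝ × ℝ →L[ℝ] ℝ × ℝ} (h : Function.Injective A) :
    Function.Bijective A :=
  ⟨h, (LinearMap.injective_iff_surjective (f := (A : ℝ × ℝ →ₗ[ℝ] ℝ × ℝ))).1 h⟩

theorem bijective_fderiv_iff {φ : ℝ × ℝ → ℝ × ℝ} {p : ℝ × ℝ} :
    Function.Bijective (fderiv ℝ φ p) ↔ jac φ p ≠ 0 := by
  constructor
  · rintro ⟨hinj, -⟩ h0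
    have key : ∀ x y : ℝ, x • du φ p + y • dv φ p = 0 → x = 0 ∧ y = 0 := by
      intro x y h
      have h1 : fderiv ℝ φ p (x, y) = fderiv ℝ φ p 0 := by
        rw [fderiv_apply_eq, h, map_zero]
      simpa using hinj h1
    simp only [jac] at h0
    -- When the determinant vanishes, the columns of the adjugate lie in the kernel. Injectivity
    -- makes them zero, so the whole matrix is zero and kills `(1, 0)`.
    have h1 := key (dv φ p).2 (-(du φ p).2) (by
      ext
      · simp; linarith
      · simp; ring)
    have h2 := key (dv φ p).1 (-(du φ p).1) (by
      ext
      · simp; ring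
      · simp; linarith)
    have h3 := key 1 0 (by
      ext
      · simpa using h2.2
      · simpa using h1.2)
    exact one_ne_zero h3.1
  · intro h
    refine clm_bijective_of_injective ((injective_iff_map_eq_zero _).2 fun q hq => ?_)
    rw [fderiv_apply_eq] at hq
    have h1 := congrArg Prod.fst hq
    have h2 := congrArg Prod.snd hq
    simp only [Prod.fst_add, Prod.snd_add, Prod.smul_fst, Prod.smul_snd, smul_eq_mul,
      Prod.fst_zero, Prod.snd_zero] at h1 h2
    have e1 : q.1 * jac φ p = 0 := by
      rw [jac]; linear_combination (dv φ p).2 * h1 - (dv φ p).1 * h2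
    have e2 : q.2 * jac φ p = 0 := by
      rw [jac]; linear_combination (du φ p).1 * h2 - (du φ p).2 * h1
    ext
    · exact (mul_eq_zero.1 e1).resolve_right h
    · exact (mul_eq_zero.1 e2).resolve_right h

/-- By the chain rule the differential of `φ` has a left inverse, so it is injective, and an
injective endomorphism of the plane is bijective. -/
theorem isDiffeoGerm_of_leftInverse {φ χ : ℝ × ℝ → ℝ × ℝ} (hφ : SmoothGermAt φ 0)
    (hχ : SmoothGermAt χ 0) (h0 : φ 0 = 0) (h : ∀ᶠ p in 𝓝 (0 : ℝ × ℝ), χ (φ p) = p) :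
    IsDiffeoGerm φ := by
  refine ⟨hφ, h0, clm_bijective_of_injective ?_⟩
  have h1 : fderiv ℝ (fun p => χ (φ p)) 0 = fderiv ℝ (fun p => p) (0 : ℝ × ℝ) :=
    EventuallyEq.fderiv_eq h
  rw [fderiv_fun_comp 0 (by rw [h0]; exact hχ.differentiableAt) hφ.differentiableAt, fderiv_fun_id] at h1
  intro a b hab
  have := congrArg (fderiv ℝ χ (φ 0)) hab
  rw [← ContinuousLinearMap.comp_apply, ← ContinuousLinearMap.comp_apply, h1] at this
  simpa using this

theorem IsDiffeoGerm.tendsto {φ : ℝ × ℝ → ℝ × ℝ} (h : IsDiffeoGerm φ) :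
    Tendsto φ (𝓝 0) (𝓝 0) := by
  have := h.1.continuousAt.tendsto
  rwa [h.2.1] at this

theorem IsDiffeoGerm.comp {φ χ : ℝ × ℝ → ℝ × ℝ} (hφ : IsDiffeoGerm φ) (hχ : IsDiffeoGerm χ) :
    IsDiffeoGerm fun p => φ (χ p) := by
  refine ⟨hφ.1.comp_of_eq hχ.1 hχ.2.1, by simp only [hχ.2.1, hφ.2.1], ?_⟩
  rw [fderiv_fun_comp 0 (by rw [hχ.2.1]; exact hφ.1.differentiableAt) hχ.1.differentiableAt, hχ.2.1]
  exact hφ.2.2.comp hχ.2.2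

/-- The inverse function theorem for germs of diffeomorphisms. -/
theorem IsDiffeoGerm.exists_inverse {φ : ℝ × ℝ → ℝ × ℝ} (h : IsDiffeoGerm φ) :
    ∃ χ : ℝ × ℝ → ℝ × ℝ, IsDiffeoGerm χ ∧ (∀ᶠ p in 𝓝 (0 : ℝ × ℝ), χ (φ p) = p) ∧
      ∀ᶠ p in 𝓝 (0 : ℝ × ℝ), φ (χ p) = p := by
  obtain ⟨hs, h0, hb⟩ := h
  have key : ∀ p, Function.Bijective (fderiv ℝ φ p) →
      ∃ e : (ℝ × ℝ) ≃L[ℝ] ℝ × ℝ, (e : ℝ × ℝ →L[ℝ] ℝ × ℝ) = fderiv ℝ φ p := fun p hp =>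
    ⟨ContinuousLinearEquiv.ofBijective (fderiv ℝ φ p) (LinearMap.ker_eq_bot.2 hp.1)
      (LinearMap.range_eq_top.2 hp.2), ContinuousLinearEquiv.coe_ofBijective _ _ _⟩
  obtain ⟨e, he⟩ := key 0 hb
  have hstrict : HasStrictFDerivAt φ (e : ℝ × ℝ →L[ℝ] ℝ × ℝ) 0 := by
    rw [he]; exact hs.contDiffAt.hasStrictFDerivAt (by simp)
  let Φ := hstrict.toOpenPartialHomeomorph φ
  have hΦ : (Φ : ℝ × ℝ → ℝ × ℝ) = φ := hstrict.toOpenPartialHomeomorph_coe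
  have hsrc : (0 : ℝ × ℝ) ∈ Φ.source := hstrict.mem_toOpenPartialHomeomorph_source
  have htgt : (0 : ℝ × ℝ) ∈ Φ.target := by
    have := Φ.map_source hsrc
    rwa [hΦ, h0] at this
  have hχ0 : Φ.symm 0 = 0 := by
    have := Φ.left_inv hsrc
    rwa [hΦ, h0] at this
  have hleft : ∀ᶠ p in 𝓝 (0 : ℝ × ℝ), Φ.symm (φ p) = p := by
    have := Φ.eventually_left_inverse hsrc
    rwa [hΦ] at this
  have hright : ∀ᶠ p in 𝓝 (0 : ℝ × ℝ), φ (Φ.symm p) = p := by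
    have := Φ.eventually_right_inverse htgt
    rwa [hΦ] at this
  have hcont : Tendsto Φ.symm (𝓝 0) (𝓝 0) := by
    have := (Φ.symm.continuousAt (x := 0) htgt).tendsto
    rwa [hχ0] at this
  -- A smooth germ must be smooth at all nearby points, so invertibility of the differential is
  -- needed near `0` and not only at `0`.
  have hjac : ∀ᶠ p in 𝓝 (0 : ℝ × ℝ), Function.Bijective (fderiv ℝ φ p) := by
    simp only [bijective_fderiv_iff]
    exact hs.smooth_jac.continuousAt.eventually_ne (bijective_fderiv_iff.1 hb)
  have hsm : SmoothGermAt Φ.symm 0 := by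
    filter_upwards [hcont.eventually hs, hcont.eventually hjac, Φ.open_target.mem_nhds htgt]
      with q h1 h2 h3
    obtain ⟨e', he'⟩ := key _ h2
    refine Φ.contDiffAt_symm (f₀' := e') h3 ?_ ?_
    · rw [he', hΦ]; exact (h1.differentiableAt (by simp)).hasFDerivAt
    · rw [hΦ]; exact h1
  exact ⟨Φ.symm, isDiffeoGerm_of_leftInverse hsm hs hχ0 hright, hleft, hright⟩

/-! ### Splitting of a function with a degenerate critical point -/

/-- `f` has the form `f 0 ± y² + ψ(x)` in the coordinates `φ`. -/
structure IsSplitting (f : ℝ × ℝ → ℝ) (φ : ℝ × ℝ → ℝ × ℝ) (ε : ℝ) (ψ : ℝ → ℝ) : Prop where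
  diffeo : IsDiffeoGerm φ
  sign : ε = 1 ∨ ε = -1
  smooth : SmoothGermAt ψ 0
  eq : ∀ᶠ p in 𝓝 (0 : ℝ × ℝ), f (φ p) = f 0 + ε * p.2 ^ 2 + ψ p.1

theorem IsSplitting.zero {f : ℝ × ℝ → ℝ} {φ : ℝ × ℝ → ℝ × ℝ} {ε : ℝ} {ψ : ℝ → ℝ}
    (h : IsSplitting f φ ε ψ) : ψ 0 = 0 := by
  simpa [h.diffeo.2.1] using h.eq.self_of_nhds

theorem IsA.exists_isSplitting {k : ℕ} {f : ℝ × ℝ → ℝ} (h : IsA k f) :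
    ∃ φ ε δ, (δ = 1 ∨ δ = -1) ∧ IsSplitting f φ ε fun x => δ * x ^ (k + 1) := by
  obtain ⟨φ, hφ, ε, δ, hε, hδ, h⟩ := h
  exact ⟨φ, ε, δ, hδ, hφ, hε, (by fun_prop : ContDiff ℝ ∞ fun x : ℝ => δ * x ^ (k + 1)).smoothGermAt 0,
    h⟩

theorem isAGe_iff {k : ℕ} {f : ℝ × ℝ → ℝ} :
    IsAGe k f ↔ ∃ φ ε ψ, IsSplitting f φ ε ψ ∧ ψ =O[𝓝 0] fun x : ℝ => x ^ (k + 1) := by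
  constructor
  · rintro ⟨φ, hφ, ε, hε, ψ, hψ, hO, h⟩
    exact ⟨φ, ε, ψ, ⟨hφ, hε, hψ, h⟩, hO⟩
  · rintro ⟨φ, ε, ψ, ⟨hφ, hε, hψ, h⟩, hO⟩
    exact ⟨φ, hφ, ε, hε, ψ, hψ, hO, h⟩

/-- A splitting of `f ∘ α`, for a diffeomorphism germ `α`, gives a splitting of `f`. -/
theorem IsSplitting.of_comp {f : ℝ × ℝ → ℝ} {α φ : ℝ × ℝ → ℝ × ℝ} {ε : ℝ} {ψ : ℝ → ℝ}
    (hα : IsDiffeoGerm α) (h : IsSplitting (fun p => f (α p)) φ ε ψ) :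
    IsSplitting f (fun p => α (φ p)) ε ψ := by
  refine ⟨hα.comp h.diffeo, h.sign, h.smooth, ?_⟩
  simpa [hα.2.1] using h.eq

theorem exists_sign_mul_pos {a : ℝ} (ha : a ≠ 0) : ∃ σ : ℝ, (σ = 1 ∨ σ = -1) ∧ 0 < σ * a := by
  rcases lt_or_gt_of_ne ha with h | h
  · exact ⟨-1, Or.inr rfl, by linarith⟩
  · exact ⟨1, Or.inl rfl, by linarith⟩

theorem SmoothGermAt.smooth_rpow {E : Type*} [NormedAddCommGroup E] [NormedSpace ℝ E] {f : E → ℝ}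
    {p : E} (hf : SmoothGermAt f p) (h : f p ≠ 0) (s : ℝ) : SmoothGermAt (fun x => f x ^ s) p := by
  filter_upwards [hf, hf.continuousAt.eventually_ne h] with q h1 h2
  exact h1.rpow_const_of_ne h2

/-- A splitting whose one-variable part has order exactly `k + 1` is an `A_k` singularity. -/
theorem IsSplitting.isA {f : ℝ × ℝ → ℝ} {φ : ℝ × ℝ → ℝ × ℝ} {ε : ℝ} {ψ : ℝ → ℝ}
    (h : IsSplitting f φ ε ψ) {k : ℕ} (h1 : ψ =O[𝓝 0] fun x : ℝ => x ^ (k + 1))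
    (h2 : ¬ ψ =O[𝓝 0] fun x : ℝ => x ^ (k + 2)) : IsA k f := by
  obtain ⟨u, hu, hψ⟩ := h.smooth.exists_eq_pow_mul _ h1
  -- If `u` vanished at `0`, a further factor `x` would split off and `ψ` would have order `k + 2`.
  have hu0 : u 0 ≠ 0 := by
    intro hu0
    obtain ⟨v, hv, huv⟩ := hu.exists_eq_mul hu0
    refine h2 ?_
    have h3 : (fun x : ℝ => x ^ (k + 2) * v x) =O[𝓝 0] fun x : ℝ => x ^ (k + 2) * 1 :=
      (isBigO_refl _ _).mul (hv.continuousAt.tendsto.isBigO_one ℝ)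
    simp only [mul_one] at h3
    refine h3.congr' ?_ EventuallyEq.rfl
    filter_upwards [hψ, huv] with x hx1 hx2
    rw [hx1, hx2]; ring
  obtain ⟨δ, hδ, hpos⟩ := exists_sign_mul_pos hu0
  have hδδ : δ * δ = 1 := by rcases hδ with rfl | rfl <;> norm_num
  have hδu : SmoothGermAt (fun x => δ * u x) 0 := (smoothGermAt_const δ 0).mul hu
  have hr : SmoothGermAt (fun x => (δ * u x) ^ ((k + 1 : ℝ)⁻¹)) 0 := hδu.smooth_rpow hpos.ne' _
  -- The `(k+1)`-st root of the positive unit `δ u` is absorbed into the coordinate, so that `ψ = δ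
  -- θ^(k+1)`.
  let θ : ℝ → ℝ := fun x => x * (δ * u x) ^ ((k + 1 : ℝ)⁻¹)
  have hθ : SmoothGermAt θ 0 := (contDiff_id.smoothGermAt 0).mul hr
  have hθψ : ∀ᶠ x in 𝓝 (0 : ℝ), ψ x = δ * θ x ^ (k + 1) := by
    filter_upwards [hψ, hδu.continuousAt.eventually_const_lt hpos] with x hx1 hx2
    have : ((δ * u x) ^ ((k + 1 : ℝ)⁻¹)) ^ (k + 1) = δ * u x := by
      have := Real.rpow_inv_natCast_pow hx2.le (Nat.succ_ne_zero k)
      simpa using this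
    simp only [θ]
    rw [hx1, mul_pow, this]
    linear_combination (-(x ^ (k + 1) * u x)) * hδδ
  let Θ : ℝ × ℝ → ℝ × ℝ := fun p => (θ p.1, p.2)
  have hΘs : SmoothGermAt Θ 0 :=
    (hθ.comp_of_eq (contDiff_fst.smoothGermAt (0 : ℝ × ℝ)) rfl).prodMk (contDiff_snd.smoothGermAt _)
  have hθ' : HasDerivAt θ ((δ * u 0) ^ ((k + 1 : ℝ)⁻¹)) 0 := by
    exact ((hasDerivAt_id (0 : ℝ)).mul hr.differentiableAt.hasDerivAt).congr_deriv (by simp)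
  have hΘ : IsDiffeoGerm Θ := by
    refine ⟨hΘs, by simp [Θ, θ], bijective_fderiv_iff.2 ?_⟩
    have e1 : du Θ 0 = ((δ * u 0) ^ ((k + 1 : ℝ)⁻¹), 0) :=
      (hasDerivAt_du hΘs.differentiableAt).unique (hθ'.prodMk (hasDerivAt_const _ _))
    have e2 : dv Θ 0 = (0, 1) := (hasDerivAt_dv hΘs.differentiableAt).unique
      ((hasDerivAt_const (0 : ℝ) (θ 0)).prodMk (hasDerivAt_id (0 : ℝ)))
    rw [jac, e1, e2]
    simpa using (Real.rpow_pos_of_pos hpos _).ne'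
  obtain ⟨χ, hχ, -, hχr⟩ := hΘ.exists_inverse
  refine ⟨fun p => φ (χ p), h.diffeo.comp hχ, ε, δ, h.sign, hδ, ?_⟩
  have ht1 : Tendsto (fun p => (χ p).1) (𝓝 0) (𝓝 0) :=
    (continuous_fst.tendsto' (0 : ℝ × ℝ) 0 rfl).comp hχ.tendsto
  filter_upwards [hχ.tendsto.eventually h.eq, hχr, ht1.eventually hθψ] with p hp1 hp2 hp3
  rw [hp1, hp3]
  obtain ⟨e1, e2⟩ : θ (χ p).1 = p.1 ∧ (χ p).2 = p.2 := Prod.ext_iff.1 hp2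
  rw [e1, e2]

/-- The splitting lemma, when the second derivative along the second axis does not vanish. -/
theorem exists_isSplitting_of_dv_dv_ne_zero {f : ℝ × ℝ → ℝ} (hf : SmoothGermAt f 0)
    (h2 : dv f 0 = 0) (h22 : dv (dv f) 0 ≠ 0) : ∃ φ ε ψ, IsSplitting f φ ε ψ := by
  -- Inverting `(x, f_v)` plays the role of the implicit function theorem: the preimage of the first
  -- axis is the graph `y = Y(x)` of the solutions of `f_v = 0`.
  let Φ : ℝ × ℝ → ℝ × ℝ := fun p => (p.1, dv f p)
  have hΦs : SmoothGermAt Φ 0 := (contDiff_fst.smoothGermAt (0 : ℝ × ℝ)).prodMk hf.smooth_dv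
  have hΦ : IsDiffeoGerm Φ := by
    refine ⟨hΦs, by simp [Φ, h2], bijective_fderiv_iff.2 ?_⟩
    have e1 : du Φ 0 = (1, du (dv f) 0) := (hasDerivAt_du hΦs.differentiableAt).unique
      ((hasDerivAt_id _).prodMk (hasDerivAt_du hf.smooth_dv.differentiableAt))
    have e2 : dv Φ 0 = (0, dv (dv f) 0) := (hasDerivAt_dv hΦs.differentiableAt).unique
      ((hasDerivAt_const _ _).prodMk (hasDerivAt_dv hf.smooth_dv.differentiableAt))
    rw [jac, e1, e2]
    simpa using h22
  obtain ⟨χ, hχ, -, hχr⟩ := hΦ.exists_inverse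
  have hxc : ContDiff ℝ ∞ fun x : ℝ => (x, (0 : ℝ)) := by fun_prop
  have hxt : Tendsto (fun x : ℝ => (x, (0 : ℝ))) (𝓝 0) (𝓝 0) := hxc.continuous.tendsto' 0 0 rfl
  let Y : ℝ → ℝ := fun x => (χ (x, 0)).2
  have hY : SmoothGermAt Y 0 := (hχ.1.comp_of_eq (hxc.smoothGermAt 0) rfl).snd
  have hY0 : Y 0 = 0 := congrArg Prod.snd hχ.2.1
  have hfY : ∀ᶠ x in 𝓝 (0 : ℝ), dv f (x, Y x) = 0 := by
    filter_upwards [hxt.eventually hχr] with x hx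
    have e1 : (χ (x, 0)).1 = x := congrArg Prod.fst hx
    have e2 : dv f (χ (x, 0)) = 0 := congrArg Prod.snd hx
    have e3 : (x, Y x) = χ (x, 0) := Prod.ext e1.symm rfl
    rw [e3, e2]
  have hY1 : SmoothGermAt (fun p : ℝ × ℝ => Y p.1) 0 :=
    hY.comp_of_eq (contDiff_fst.smoothGermAt (0 : ℝ × ℝ)) rfl
  -- This shear moves the critical curve to the first axis. There `f ∘ S - f 0 - ψ` vanishes
  -- together with its `y`-derivative, so Hadamard's lemma applies twice and extracts `y²`.
  let S : ℝ × ℝ → ℝ × ℝ := fun p => (p.1, Y p.1 + p.2)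
  have hSs : SmoothGermAt S 0 := (contDiff_fst.smoothGermAt (0 : ℝ × ℝ)).prodMk
    (hY1.add (contDiff_snd.smoothGermAt _))
  have hS0 : S 0 = 0 := by simp [S, hY0]
  have hS : IsDiffeoGerm S := by
    refine isDiffeoGerm_of_leftInverse (χ := fun p => (p.1, p.2 - Y p.1)) hSs ?_ hS0 ?_
    · exact (contDiff_fst.smoothGermAt (0 : ℝ × ℝ)).prodMk ((contDiff_snd.smoothGermAt _).sub hY1)
    · exact Eventually.of_forall fun p => by simp [S]
  let ψ : ℝ → ℝ := fun x => f (x, Y x) - f 0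
  have hgr : SmoothGermAt (fun x => (x, Y x)) 0 := (contDiff_id.smoothGermAt (0 : ℝ)).prodMk hY
  have hψ : SmoothGermAt ψ 0 :=
    (hf.comp_of_eq hgr (by simp [hY0])).sub (smoothGermAt_const _ _)
  let K : ℝ × ℝ → ℝ := fun p => f (S p) - f 0 - ψ p.1
  have hfS : SmoothGermAt (fun p => f (S p)) 0 := hf.comp_of_eq hSs hS0
  have hK : SmoothGermAt K 0 := (hfS.sub (smoothGermAt_const _ _)).sub
    (hψ.comp_of_eq (contDiff_fst.smoothGermAt (0 : ℝ × ℝ)) rfl)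
  obtain ⟨r, hr, hKr⟩ := hK.exists_eq_snd_mul (Eventually.of_forall fun x => by simp [K, S, ψ])
  have hr0 : ∀ᶠ x in 𝓝 (0 : ℝ), r (x, 0) = 0 := by
    filter_upwards [hfY, hxt.eventually hKr.eventually_nhds,
      hxt.eventually hr.eventually_differentiableAt,
      (show Tendsto (fun x => S (x, 0)) (𝓝 0) (𝓝 0) from hS.tendsto.comp hxt).eventually
        hf.eventually_differentiableAt] with x hx1 hx2 hx3 hx4
    have ht : Tendsto (fun y : ℝ => (x, y)) (𝓝 0) (𝓝 (x, 0)) :=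
      (by fun_prop : Continuous fun y : ℝ => (x, y)).tendsto' _ _ rfl
    have d1 : HasDerivAt (fun y => K (x, y)) (dv f (x, Y x)) 0 := by
      have h3 : HasDerivAt (fun y => f (x, y)) (dv f (x, Y x)) (Y x + 0) := by
        rw [add_zero]
        exact hasDerivAt_dv (p := (x, Y x)) (by simpa [S] using hx4)
      have h4 := (h3.comp (0 : ℝ) ((hasDerivAt_id (0 : ℝ)).const_add (Y x)))
      simpa [K, S] using (h4.sub_const (f 0)).sub_const (ψ x)
    have d2 : HasDerivAt (fun y => K (x, y)) (r (x, 0)) 0 := by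
      have h3 := (hasDerivAt_id (0 : ℝ)).mul (hasDerivAt_dv hx3)
      have h4 := h3.congr_of_eventuallyEq (ht.eventually hx2)
      simpa using h4
    rw [← d2.unique d1] at hx1
    exact hx1
  obtain ⟨R, hR, hrR⟩ := hr.exists_eq_snd_mul hr0
  have hmain : ∀ᶠ p in 𝓝 (0 : ℝ × ℝ), f (S p) = f 0 + ψ p.1 + p.2 ^ 2 * R p := by
    filter_upwards [hKr, hrR] with p hp1 hp2
    rw [hp2] at hp1
    simp only [K] at hp1
    linear_combination hp1
  -- The second `y`-derivative of `f ∘ S` at `0` is computed in two ways: it is `f_vv(0)`, since `S`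
  -- is a translation in `y`, and it is `2 R(0)`.
  have hR0 : R 0 ≠ 0 := by
    have d1 : dv (fun p => f (S p)) =ᶠ[𝓝 0] fun p => dv f (S p) := by
      filter_upwards [hSs.eventually_differentiableAt,
        hS.tendsto.eventually hf.eventually_differentiableAt] with p hp1 hp2
      have e : dv S p = (0, 1) := by
        refine (hasDerivAt_dv hp1).unique ?_
        simpa [S] using (hasDerivAt_const p.2 p.1).prodMk ((hasDerivAt_id p.2).const_add (Y p.1))
      rw [dv_comp hp2 hp1, e]
      simp
    have d2 : dv (dv fun p => f (S p)) 0 = dv (dv f) 0 := by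
      have e : dv S 0 = (0, 1) := by
        refine (hasDerivAt_dv hSs.differentiableAt).unique ?_
        simpa [S] using (hasDerivAt_const (0 : ℝ) (0 : ℝ)).prodMk
          ((hasDerivAt_id (0 : ℝ)).const_add (Y 0))
      rw [dv_congr d1, dv_comp (by rw [hS0]; exact hf.smooth_dv.differentiableAt)
        hSs.differentiableAt, e, hS0]
      simp
    have d3 : dv (fun p => f (S p)) =ᶠ[𝓝 0] fun p => p.2 * (2 * R p + p.2 * dv R p) := by
      filter_upwards [hmain.eventually_nhds, hR.eventually_differentiableAt,
        hfS.eventually_differentiableAt] with p hp1 hp2 hp3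
      have ht : Tendsto (fun y : ℝ => (p.1, y)) (𝓝 p.2) (𝓝 p) :=
        (by fun_prop : Continuous fun y : ℝ => (p.1, y)).tendsto' _ _ rfl
      refine (hasDerivAt_dv hp3).unique ?_
      have h3 := ((hasDerivAt_pow 2 p.2).mul (hasDerivAt_dv hp2)).const_add (f 0 + ψ p.1)
      have h4 := h3.congr_of_eventuallyEq (ht.eventually hp1)
      convert h4 using 1
      simp; ring
    have d4 : dv (dv fun p => f (S p)) 0 = 2 * R 0 := by
      have hs : SmoothGermAt (fun p : ℝ × ℝ => 2 * R p + p.2 * dv R p) 0 :=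
        ((smoothGermAt_const 2 0).mul hR).add ((contDiff_snd.smoothGermAt _).mul hR.smooth_dv)
      rw [dv_congr d3]
      have h3 := (hasDerivAt_id (0 : ℝ)).mul (hasDerivAt_dv hs.differentiableAt)
      refine (hasDerivAt_dv ((contDiff_snd.smoothGermAt _).mul hs).differentiableAt).unique ?_
      exact h3.congr_deriv (by simp [← Prod.zero_eq_mk])
    intro h0
    rw [← d2, d4, h0, mul_zero] at h22
    exact h22 rfl
  obtain ⟨σ, hσ, hpos⟩ := exists_sign_mul_pos hR0
  have hσσ : σ * σ = 1 := by rcases hσ with rfl | rfl <;> norm_num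
  have hσR : SmoothGermAt (fun p => σ * R p) 0 := (smoothGermAt_const σ 0).mul hR
  -- With `σ` the sign of `R(0)`, the coordinate `y q` turns `y² R` into `σ (y q)²`.
  let q : ℝ × ℝ → ℝ := fun p => (σ * R p) ^ ((2 : ℝ)⁻¹)
  have hq : SmoothGermAt q 0 := hσR.smooth_rpow hpos.ne' _
  have hq2 : ∀ᶠ p in 𝓝 (0 : ℝ × ℝ), q p ^ 2 = σ * R p := by
    filter_upwards [hσR.continuousAt.eventually_const_lt hpos] with p hp
    have := Real.rpow_inv_natCast_pow (n := 2) (le_of_lt hp) two_ne_zero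
    simpa [q] using this
  let Θ : ℝ × ℝ → ℝ × ℝ := fun p => (p.1, p.2 * q p)
  have hΘs : SmoothGermAt Θ 0 := (contDiff_fst.smoothGermAt (0 : ℝ × ℝ)).prodMk
    ((contDiff_snd.smoothGermAt _).mul hq)
  have hΘ : IsDiffeoGerm Θ := by
    refine ⟨hΘs, by simp [Θ], bijective_fderiv_iff.2 ?_⟩
    have e1 : du Θ 0 = (1, 0) := by
      have h3 := (hasDerivAt_id (0 : ℝ)).prodMk
        ((hasDerivAt_const (0 : ℝ) (0 : ℝ)).mul (hasDerivAt_du hq.differentiableAt))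
      refine (hasDerivAt_du hΘs.differentiableAt).unique ?_
      exact h3.congr_deriv (by simp)
    have e2 : dv Θ 0 = (0, q 0) := by
      have h3 := (hasDerivAt_const (0 : ℝ) (0 : ℝ)).prodMk
        ((hasDerivAt_id (0 : ℝ)).mul (hasDerivAt_dv hq.differentiableAt))
      refine (hasDerivAt_dv hΘs.differentiableAt).unique ?_
      exact h3.congr_deriv (by simp [← Prod.zero_eq_mk])
    rw [jac, e1, e2]
    simpa using (Real.rpow_pos_of_pos hpos _).ne'
  obtain ⟨ξ, hξ, -, hξr⟩ := hΘ.exists_inverse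
  refine ⟨fun p => S (ξ p), σ, ψ, hS.comp hξ, hσ, hψ, ?_⟩
  filter_upwards [hξ.tendsto.eventually hmain, hξr, hξ.tendsto.eventually hq2] with p hp1 hp2 hp3
  obtain ⟨e1, e2⟩ : (ξ p).1 = p.1 ∧ (ξ p).2 * q (ξ p) = p.2 := Prod.ext_iff.1 hp2
  rw [hp1, e1, ← e2]
  linear_combination (-(σ * (ξ p).2 ^ 2)) * hp3 - (ξ p).2 ^ 2 * R (ξ p) * hσσ

/-- The second derivative of `f` along the image of the second axis under a linear map. -/
theorem dv_dv_comp_linear {f : ℝ × ℝ → ℝ} (hf : SmoothGermAt f 0) (A : ℝ × ℝ →L[ℝ] ℝ × ℝ) :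
    dv (fun p => f (A p)) 0 = (A (0, 1)).1 * du f 0 + (A (0, 1)).2 * dv f 0 ∧
    dv (dv fun p => f (A p)) 0 = (A (0, 1)).1 ^ 2 * du (du f) 0
      + 2 * ((A (0, 1)).1 * (A (0, 1)).2) * dv (du f) 0 + (A (0, 1)).2 ^ 2 * dv (dv f) 0 := by
  have hA : ∀ p, dv A p = A (0, 1) := fun p => by rw [dv, A.fderiv]
  have ht : Tendsto A (𝓝 0) (𝓝 0) := A.continuous.tendsto' 0 0 (map_zero A)
  have h1 : dv (fun p => f (A p)) =ᶠ[𝓝 0] fun p =>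
      (A (0, 1)).1 * du f (A p) + (A (0, 1)).2 * dv f (A p) := by
    filter_upwards [ht.eventually hf.eventually_differentiableAt] with p hp
    rw [dv_comp hp A.differentiableAt, hA]
    rfl
  refine ⟨by simpa using h1.self_of_nhds, ?_⟩
  have hu : DifferentiableAt ℝ (du f) (A 0) := by
    rw [map_zero]; exact hf.smooth_du.differentiableAt
  have hv : DifferentiableAt ℝ (dv f) (A 0) := by
    rw [map_zero]; exact hf.smooth_dv.differentiableAt
  have h2 : dv (fun p => (A (0, 1)).1 * du f (A p) + (A (0, 1)).2 * dv f (A p)) 0 =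
      (A (0, 1)).1 * dv (fun p => du f (A p)) 0 + (A (0, 1)).2 * dv (fun p => dv f (A p)) 0 := by
    have hu' : DifferentiableAt ℝ (fun p => du f (A p)) 0 := hu.comp 0 A.differentiableAt
    have hv' : DifferentiableAt ℝ (fun p => dv f (A p)) 0 := hv.comp 0 A.differentiableAt
    rw [dv, fderiv_fun_add (hu'.const_mul _) (hv'.const_mul _), fderiv_const_mul hu',
      fderiv_const_mul hv']
    rfl
  rw [dv_congr h1, h2, dv_comp hu A.differentiableAt, dv_comp hv A.differentiableAt, hA, map_zero,
    du_dv_comm hf.contDiffAt]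
  simp only [smul_eq_mul]
  ring

/-- The splitting lemma: at a critical point with non-zero Hessian, a function of two variables is
the sum of `± y²` and of a function of `x`, in suitable coordinates. -/
theorem exists_isSplitting {f : ℝ × ℝ → ℝ} (hf : SmoothGermAt f 0) (h1 : du f 0 = 0)
    (h2 : dv f 0 = 0) (hne : ¬ (du (du f) 0 = 0 ∧ dv (du f) 0 = 0 ∧ dv (dv f) 0 = 0)) :
    ∃ φ ε ψ, IsSplitting f φ ε ψ := by
  -- A non-zero quadratic form is non-zero on one of `(0, 1)`, `(1, 0)`, `(1, 1)`; the chosen vector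
  -- `(b, d)` becomes the second axis.
  obtain ⟨a, b, c, d, hdet, hab⟩ : ∃ a b c d : ℝ, a * d - b * c ≠ 0 ∧
      b ^ 2 * du (du f) 0 + 2 * (b * d) * dv (du f) 0 + d ^ 2 * dv (dv f) 0 ≠ 0 := by
    by_cases h22 : dv (dv f) 0 = 0
    · by_cases h11 : du (du f) 0 = 0
      · refine ⟨1, 1, 0, 1, by norm_num, ?_⟩
        have : dv (du f) 0 ≠ 0 := fun h => hne ⟨h11, h, h22⟩
        simpa [h11, h22] using this
      · exact ⟨0, 1, 1, 0, by norm_num, by simpa using h11⟩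
    · exact ⟨1, 0, 0, 1, by norm_num, by simpa using h22⟩
  let A : ℝ × ℝ →L[ℝ] ℝ × ℝ :=
    (a • ContinuousLinearMap.fst ℝ ℝ ℝ + b • ContinuousLinearMap.snd ℝ ℝ ℝ).prod
      (c • ContinuousLinearMap.fst ℝ ℝ ℝ + d • ContinuousLinearMap.snd ℝ ℝ ℝ)
  have hA1 : A (0, 1) = (b, d) := by simp [A]
  have hA0 : A (1, 0) = (a, c) := by simp [A]
  have hA : IsDiffeoGerm A := by
    refine ⟨A.contDiff.smoothGermAt 0, map_zero A, bijective_fderiv_iff.2 ?_⟩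
    rw [jac, du, dv, A.fderiv, hA1, hA0]
    exact hdet
  obtain ⟨e1, e2⟩ := dv_dv_comp_linear hf A
  rw [hA1] at e1 e2
  obtain ⟨φ, ε, ψ, h⟩ := exists_isSplitting_of_dv_dv_ne_zero (f := fun p => f (A p))
    (hf.comp_of_eq hA.1 (map_zero A)) (by rw [e1, h1, h2]; simp) (by rw [e2]; exact hab)
  exact ⟨_, ε, ψ, h.of_comp hA⟩

/-! ### The cross product -/

theorem inner_E3 (a b : E3) : inner ℝ a b = a 0 * b 0 + a 1 * b 1 + a 2 * b 2 := by
  simp [PiLp.inner_apply, Fin.sum_univ_three]; ring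

theorem cross_zero_coord (a b : E3) : cross a b 0 = a 1 * b 2 - a 2 * b 1 := by
  simp [cross, cross_apply]

theorem cross_one_coord (a b : E3) : cross a b 1 = a 2 * b 0 - a 0 * b 2 := by
  simp [cross, cross_apply]

theorem cross_two_coord (a b : E3) : cross a b 2 = a 0 * b 1 - a 1 * b 0 := by
  simp [cross, cross_apply]

theorem E3_ext {a b : E3} (h0 : a 0 = b 0) (h1 : a 1 = b 1) (h2 : a 2 = b 2) : a = b := by
  ext i; fin_cases i
  exacts [h0, h1, h2]

theorem inner_cross_left (a b : E3) : inner ℝ a (cross a b) = 0 := by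
  simp only [inner_E3, cross_zero_coord, cross_one_coord, cross_two_coord]; ring

theorem inner_cross_right (a b : E3) : inner ℝ b (cross a b) = 0 := by
  simp only [inner_E3, cross_zero_coord, cross_one_coord, cross_two_coord]; ring

theorem cross_comb (a b : E3) (p q r s : ℝ) :
    cross (p • a + q • b) (r • a + s • b) = (p * s - r * q) • cross a b := by
  refine E3_ext ?_ ?_ ?_ <;>
  simp only [cross_zero_coord, cross_one_coord, cross_two_coord, PiLp.add_apply, PiLp.smul_apply,
    smul_eq_mul] <;> ring

/-- Expansion of an inner product in the frame `a`, `b`, `a × b`. -/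
theorem inner_frame (a b z w : E3) :
    (inner ℝ a a * inner ℝ b b - inner ℝ a b ^ 2) * inner ℝ z w =
      inner ℝ w (cross a b) * inner ℝ z (cross a b)
      + inner ℝ a w * (inner ℝ b b * inner ℝ z a - inner ℝ a b * inner ℝ z b)
      + inner ℝ b w * (inner ℝ a a * inner ℝ z b - inner ℝ a b * inner ℝ z a) := by
  simp only [inner_E3, cross_zero_coord, cross_one_coord, cross_two_coord]; ring

/-- Lagrange's identity. -/
theorem gram_eq_norm_cross_sq (a b : E3) :
    inner ℝ a a * inner ℝ b b - inner ℝ a b ^ 2 = ‖cross a b‖ ^ 2 := by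
  rw [← real_inner_self_eq_norm_sq]
  simp only [inner_E3, cross_zero_coord, cross_one_coord, cross_two_coord]; ring

/-- A vector orthogonal to `a` and `b` is a multiple of `a × b`. -/
theorem norm_cross_sq_smul {a b w : E3} (ha : inner ℝ a w = 0) (hb : inner ℝ b w = 0) :
    ‖cross a b‖ ^ 2 • w = inner ℝ w (cross a b) • cross a b := by
  refine ext_inner_left ℝ fun z => ?_
  have := inner_frame a b z w
  rw [ha, hb, gram_eq_norm_cross_sq] at this
  rw [inner_smul_right, inner_smul_right]
  linear_combination this

/-- A unit vector orthogonal to `a` and `b` is, up to sign, the normalisation of `a × b`. -/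
theorem eq_or_eq_neg_normalize_cross {a b w : E3} (ha : inner ℝ a w = 0) (hb : inner ℝ b w = 0)
    (hw : ‖w‖ = 1) (h : cross a b ≠ 0) :
    ‖cross a b‖⁻¹ • cross a b = w ∨ ‖cross a b‖⁻¹ • cross a b = -w := by
  set m := cross a b with hm
  have hn : ‖m‖ ≠ 0 := norm_ne_zero_iff.2 h
  have h1 : w = (inner ℝ w m / ‖m‖) • (‖m‖⁻¹ • m) := by
    have h2 := norm_cross_sq_smul ha hb
    rw [← hm] at h2
    have h3 : w = (‖m‖ ^ 2)⁻¹ • (‖m‖ ^ 2 • w) := by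
      rw [smul_smul, inv_mul_cancel₀ (pow_ne_zero 2 hn), one_smul]
    rw [h2, smul_smul] at h3
    rw [smul_smul]
    convert h3 using 2
    field_simp
  set c := inner ℝ w m / ‖m‖
  have hc : |c| = 1 := by
    have h2 := congrArg norm h1
    rw [hw, norm_smul, norm_smul, norm_inv, norm_norm, inv_mul_cancel₀ hn, mul_one] at h2
    exact h2.symm
  rcases eq_or_eq_neg_of_abs_eq hc with h2 | h2
  · left; rw [h1, h2, one_smul]
  · right; rw [h1, h2, neg_smul, neg_neg, one_smul]

/-- The cross product as a continuous bilinear map. -/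
noncomputable def crossL : E3 →L[ℝ] E3 →L[ℝ] E3 :=
  (LinearMap.mk₂ ℝ cross
    (fun a b c => by
      refine E3_ext ?_ ?_ ?_ <;> simp only [cross_zero_coord, cross_one_coord, cross_two_coord,
        PiLp.add_apply] <;> ring)
    (fun r a b => by
      refine E3_ext ?_ ?_ ?_ <;> simp only [cross_zero_coord, cross_one_coord, cross_two_coord,
        PiLp.smul_apply, smul_eq_mul] <;> ring)
    (fun a b c => by
      refine E3_ext ?_ ?_ ?_ <;> simp only [cross_zero_coord, cross_one_coord, cross_two_coord,
        PiLp.add_apply] <;> ring)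
    (fun r a b => by
      refine E3_ext ?_ ?_ ?_ <;> simp only [cross_zero_coord, cross_one_coord, cross_two_coord,
        PiLp.smul_apply, smul_eq_mul] <;> ring)).toContinuousBilinearMap

theorem SmoothGermAt.smooth_cross {E : Type*} [NormedAddCommGroup E] [NormedSpace ℝ E]
    {f g : E → E3} {p : E} (hf : SmoothGermAt f p) (hg : SmoothGermAt g p) :
    SmoothGermAt (fun x => cross (f x) (g x)) p := by
  filter_upwards [hf, hg] with q h1 h2
  exact (contDiffAt_const (c := crossL).clm_apply h1).clm_apply h2

theorem _root_.HasDerivAt.cross {f g : ℝ → E3} {f' g' : E3} {t : ℝ} (hf : HasDerivAt f f' t)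
    (hg : HasDerivAt g g' t) :
    HasDerivAt (fun s => cross (f s) (g s)) (cross f' (g t) + cross (f t) g') t := by
  have h1 : HasDerivAt (fun s => crossL (f s)) (crossL f') t := crossL.hasFDerivAt.comp_hasDerivAt t hf
  exact h1.clm_apply hg

/-! ### The parabolic function under a change of parameters -/

section Product

variable {F : Type*} [NormedAddCommGroup F] [NormedSpace ℝ F]

theorem du_smul_add {a b : ℝ × ℝ → ℝ} {X Y : ℝ × ℝ → F} {p : ℝ × ℝ} (ha : DifferentiableAt ℝ a p)
    (hb : DifferentiableAt ℝ b p) (hX : DifferentiableAt ℝ X p) (hY : DifferentiableAt ℝ Y p) :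
    du (fun q => a q • X q + b q • Y q) p =
      (a p • du X p + du a p • X p) + (b p • du Y p + du b p • Y p) :=
  (hasDerivAt_du ((ha.smul hX).add (hb.smul hY))).unique
    (((hasDerivAt_du ha).smul (hasDerivAt_du hX)).add ((hasDerivAt_du hb).smul (hasDerivAt_du hY)))

theorem dv_smul_add {a b : ℝ × ℝ → ℝ} {X Y : ℝ × ℝ → F} {p : ℝ × ℝ} (ha : DifferentiableAt ℝ a p)
    (hb : DifferentiableAt ℝ b p) (hX : DifferentiableAt ℝ X p) (hY : DifferentiableAt ℝ Y p) :
    dv (fun q => a q • X q + b q • Y q) p =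
      (a p • dv X p + dv a p • X p) + (b p • dv Y p + dv b p • Y p) :=
  (hasDerivAt_dv ((ha.smul hX).add (hb.smul hY))).unique
    (((hasDerivAt_dv ha).smul (hasDerivAt_dv hX)).add ((hasDerivAt_dv hb).smul (hasDerivAt_dv hY)))

end Product

theorem SmoothGermAt.smooth_normalField {g : ℝ × ℝ → E3} {p : ℝ × ℝ} (h : SmoothGermAt g p) :
    SmoothGermAt (normalField g) p := h.smooth_du.smooth_cross h.smooth_dv

theorem SmoothGermAt.smooth_parabolicFn {g : ℝ × ℝ → E3} {p : ℝ × ℝ} (h : SmoothGermAt g p) :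
    SmoothGermAt (parabolicFn g) p :=
  ((h.smooth_du.smooth_du.smooth_inner h.smooth_normalField).mul
    (h.smooth_dv.smooth_dv.smooth_inner h.smooth_normalField)).sub
      ((h.smooth_du.smooth_dv.smooth_inner h.smooth_normalField).pow 2)

theorem normalField_comp {g : ℝ × ℝ → E3} {φ : ℝ × ℝ → ℝ × ℝ} {p : ℝ × ℝ}
    (hg : DifferentiableAt ℝ g (φ p)) (hφ : DifferentiableAt ℝ φ p) :
    normalField (fun q => g (φ q)) p = jac φ p • normalField g (φ p) := by
  rw [normalField, du_comp hg hφ, dv_comp hg hφ, cross_comb]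
  rfl

/-- `Σ` is the determinant of the matrix of second derivatives paired with `g_u × g_v`. Terms with
second derivatives of `φ` are tangential and drop out. The congruence of the matrix contributes
`jac²`, and the factor `jac` on the normal contributes another `jac²`. -/
theorem parabolicFn_comp {g : ℝ × ℝ → E3} {φ : ℝ × ℝ → ℝ × ℝ} {p : ℝ × ℝ}
    (hg : SmoothGermAt g (φ p)) (hφ : SmoothGermAt φ p) :
    parabolicFn (fun q => g (φ q)) p = jac φ p ^ 4 * parabolicFn g (φ p) := by
  have hgd := hφ.continuousAt.eventually hg.eventually_differentiableAt
  have hu : du (fun q => g (φ q)) =ᶠ[𝓝 p]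
      fun q => (du φ q).1 • du g (φ q) + (du φ q).2 • dv g (φ q) := by
    filter_upwards [hgd, hφ.eventually_differentiableAt] with q h1 h2 using du_comp h1 h2
  have hv : dv (fun q => g (φ q)) =ᶠ[𝓝 p]
      fun q => (dv φ q).1 • du g (φ q) + (dv φ q).2 • dv g (φ q) := by
    filter_upwards [hgd, hφ.eventually_differentiableAt] with q h1 h2 using dv_comp h1 h2
  have d1 := hφ.smooth_du.fst.differentiableAt
  have d2 := hφ.smooth_du.snd.differentiableAt
  have d3 := hφ.smooth_dv.fst.differentiableAt
  have d4 := hφ.smooth_dv.snd.differentiableAt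
  have d5 := (hg.smooth_du.comp hφ).differentiableAt
  have d6 := (hg.smooth_dv.comp hφ).differentiableAt
  have c1 := hg.smooth_du.differentiableAt
  have c2 := hg.smooth_dv.differentiableAt
  have c3 := hφ.differentiableAt
  have n1 : inner ℝ (du g (φ p)) (normalField g (φ p)) = 0 := inner_cross_left _ _
  have n2 : inner ℝ (dv g (φ p)) (normalField g (φ p)) = 0 := inner_cross_right _ _
  rw [parabolicFn, parabolicFn, normalField_comp hg.differentiableAt c3, du_congr hu, dv_congr hu,
    dv_congr hv, du_smul_add d1 d2 d5 d6, dv_smul_add d1 d2 d5 d6, dv_smul_add d3 d4 d5 d6,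
    du_comp c1 c3, du_comp c2 c3, dv_comp c1 c3, dv_comp c2 c3, du_dv_comm hg.contDiffAt]
  simp only [inner_add_left, inner_smul_left, inner_smul_right, n1, n2, jac,
    RCLike.conj_to_real]
  ring

/-- The differential of the parabolic function under a change of parameters. -/
theorem fderiv_parabolicFn_comp_ne_zero {g : ℝ × ℝ → E3} {φ : ℝ × ℝ → ℝ × ℝ}
    (hg : SmoothGermAt g 0) (hφ : IsDiffeoGerm φ) (h0 : parabolicFn g 0 = 0)
    (h : fderiv ℝ (parabolicFn g) 0 ≠ 0) :
    fderiv ℝ (parabolicFn fun q => g (φ q)) 0 ≠ 0 := by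
  have hg' : SmoothGermAt g (φ 0) := by rw [hφ.2.1]; exact hg
  have heq : parabolicFn (fun q => g (φ q)) =ᶠ[𝓝 0]
      fun p => jac φ p ^ 4 * parabolicFn g (φ p) := by
    filter_upwards [hφ.tendsto.eventually (eventually_eventually_nhds.2 hg),
      eventually_eventually_nhds.2 hφ.1] with p h1 h2
    exact parabolicFn_comp h1 h2
  have hs := hg'.smooth_parabolicFn
  rw [heq.fderiv_eq, fderiv_fun_mul ((hφ.1.smooth_jac.pow 4).differentiableAt)
    (hs.comp hφ.1).differentiableAt, fderiv_fun_comp 0 hs.differentiableAt hφ.1.differentiableAt,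
    hφ.2.1, h0, zero_smul, add_zero]
  intro hz
  refine h (ContinuousLinearMap.ext fun v => ?_)
  obtain ⟨u, rfl⟩ := hφ.2.2.2 v
  have := congrArg (fun A : ℝ × ℝ →L[ℝ] ℝ => A u) hz
  simp only [smul_apply, ContinuousLinearMap.comp_apply, smul_eq_mul,
    zero_apply] at this
  exact (mul_eq_zero.1 this).resolve_left (pow_ne_zero 4 (bijective_fderiv_iff.1 hφ.2.2))

theorem isBigO_pow_pow {m n : ℕ} (h : m ≤ n) :
    (fun x : ℝ => x ^ n) =O[𝓝 0] fun x : ℝ => x ^ m := by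
  obtain ⟨d, rfl⟩ := Nat.exists_eq_add_of_le h
  have h1 : (fun x : ℝ => x ^ d) =O[𝓝 0] fun _ => (1 : ℝ) :=
    (continuous_pow d).continuousAt.tendsto.isBigO_one ℝ
  simpa [pow_add] using (isBigO_refl (fun x : ℝ => x ^ m) (𝓝 0)).mul h1

/-! ### Surfaces in coordinates splitting the height function -/

theorem du_inner_const {X : ℝ × ℝ → E3} (w : E3) {p : ℝ × ℝ} (hX : DifferentiableAt ℝ X p) :
    du (fun q => inner ℝ (X q) w) p = inner ℝ (du X p) w := by
  rw [du, fderiv_inner_apply ℝ hX (differentiableAt_const w)]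
  simp [du]

theorem dv_inner_const {X : ℝ × ℝ → E3} (w : E3) {p : ℝ × ℝ} (hX : DifferentiableAt ℝ X p) :
    dv (fun q => inner ℝ (X q) w) p = inner ℝ (dv X p) w := by
  rw [dv, fderiv_inner_apply ℝ hX (differentiableAt_const w)]
  simp [dv]

/-- A surface germ with `⟨g, w⟩ = ε y² + ψ(x)`, where `w` is normal at the origin, which is a
parabolic point at which the parabolic set is regular. -/
structure IsSplitSurface (g : ℝ × ℝ → E3) (w : E3) (ε : ℝ) (ψ : ℝ → ℝ) : Prop where
  smooth : SmoothGermAt g 0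
  normal_ne : normalField g 0 ≠ 0
  smooth_fn : SmoothGermAt ψ 0
  sign : ε ≠ 0
  fn_zero : ψ 0 = 0
  w_ne : w ≠ 0
  inner_du : inner ℝ (du g 0) w = 0
  inner_dv : inner ℝ (dv g 0) w = 0
  height_eq : ∀ᶠ p in 𝓝 (0 : ℝ × ℝ), height g w p = ε * p.2 ^ 2 + ψ p.1
  parabolic : parabolicFn g 0 = 0
  regular : fderiv ℝ (parabolicFn g) 0 ≠ 0

section SplitSurface

variable {g : ℝ × ℝ → E3} {w : E3} {ε : ℝ} {ψ : ℝ → ℝ}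

theorem IsSplitSurface.inner_first (h : IsSplitSurface g w ε ψ) :
    ∀ᶠ p in 𝓝 (0 : ℝ × ℝ), inner ℝ (du g p) w = deriv ψ p.1 ∧ inner ℝ (dv g p) w = 2 * ε * p.2 := by
  have hfst : Tendsto (fun p : ℝ × ℝ => p.1) (𝓝 0) (𝓝 0) := continuous_fst.tendsto' _ _ rfl
  filter_upwards [h.height_eq.eventually_nhds, h.smooth.eventually_differentiableAt,
    hfst.eventually h.smooth_fn.eventually_differentiableAt] with p h1 h2 h3
  have h1' : (fun q => inner ℝ (g q) w) =ᶠ[𝓝 p] fun q => ε * q.2 ^ 2 + ψ q.1 := h1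
  have hd : DifferentiableAt ℝ (fun q : ℝ × ℝ => ε * q.2 ^ 2 + ψ q.1) p :=
    ((differentiableAt_snd.pow 2).const_mul ε).add (h3.comp p differentiableAt_fst)
  rw [← du_inner_const w h2, ← dv_inner_const w h2, du_congr h1', dv_congr h1']
  constructor
  · refine (hasDerivAt_du hd).unique ?_
    simpa using h3.hasDerivAt.const_add (ε * p.2 ^ 2)
  · refine (hasDerivAt_dv hd).unique ?_
    exact (((hasDerivAt_pow 2 p.2).const_mul ε).add_const (ψ p.1)).congr_deriv (by simp; ring)

theorem IsSplitSurface.inner_second (h : IsSplitSurface g w ε ψ) :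
    ∀ᶠ p in 𝓝 (0 : ℝ × ℝ), inner ℝ (du (du g) p) w = deriv (deriv ψ) p.1 ∧
      inner ℝ (dv (du g) p) w = 0 ∧ inner ℝ (dv (dv g) p) w = 2 * ε := by
  have hfst : Tendsto (fun p : ℝ × ℝ => p.1) (𝓝 0) (𝓝 0) := continuous_fst.tendsto' _ _ rfl
  filter_upwards [h.inner_first.eventually_nhds, h.smooth.smooth_du.eventually_differentiableAt,
    h.smooth.smooth_dv.eventually_differentiableAt,
    hfst.eventually h.smooth_fn.smooth_deriv.eventually_differentiableAt] with p h1 h2 h3 h4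
  have e1 : (fun q => inner ℝ (du g q) w) =ᶠ[𝓝 p] fun q => deriv ψ q.1 := h1.mono fun _ hq => hq.1
  have e2 : (fun q => inner ℝ (dv g q) w) =ᶠ[𝓝 p] fun q => 2 * ε * q.2 := h1.mono fun _ hq => hq.2
  have hd : DifferentiableAt ℝ (fun q : ℝ × ℝ => deriv ψ q.1) p := h4.comp p differentiableAt_fst
  rw [← du_inner_const w h2, ← dv_inner_const w h2, ← dv_inner_const w h3, du_congr e1, dv_congr e1,
    dv_congr e2]
  refine ⟨(hasDerivAt_du hd).unique h4.hasDerivAt, (hasDerivAt_dv hd).unique (hasDerivAt_const p.2 (deriv ψ p.1)),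
    (hasDerivAt_dv (differentiableAt_snd.const_mul (2 * ε))).unique ?_⟩
  simpa using (hasDerivAt_id p.2).const_mul (2 * ε)

theorem IsSplitSurface.deriv_zero (h : IsSplitSurface g w ε ψ) : deriv ψ 0 = 0 := by
  have := h.inner_first.self_of_nhds.1
  rw [h.inner_du] at this
  exact this.symm

/-- Along the first axis, the parabolic function is, up to units, a combination of `ψ''` and
`ψ'`. -/
theorem IsSplitSurface.exists_parabolicFn_eq (h : IsSplitSurface g w ε ψ) :
    ∃ A B R : ℝ → ℝ, SmoothGermAt A 0 ∧ SmoothGermAt B 0 ∧ SmoothGermAt R 0 ∧ A 0 ≠ 0 ∧ B 0 ≠ 0 ∧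
      ∀ᶠ x in 𝓝 (0 : ℝ), A x * parabolicFn g (x, 0) =
        B x * deriv (deriv ψ) x + R x * deriv ψ x := by
  let κ : ℝ × ℝ → ℝ := fun p => inner ℝ w (normalField g p)
  let D : ℝ × ℝ → ℝ := fun p => inner ℝ (du g p) (du g p) * inner ℝ (dv g p) (dv g p) -
    inner ℝ (du g p) (dv g p) ^ 2
  -- The coefficient of `⟨g_u, w⟩` in `inner_frame`. That of `⟨g_v, w⟩` is not needed, because
  -- `⟨g_v, w⟩ = 2 ε y` vanishes on the first axis.
  let T : (ℝ × ℝ → E3) → ℝ × ℝ → ℝ := fun z p => inner ℝ (dv g p) (dv g p) * inner ℝ (z p) (du g p) -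
    inner ℝ (du g p) (dv g p) * inner ℝ (z p) (dv g p)
  have su := h.smooth.smooth_du
  have sv := h.smooth.smooth_dv
  have hT : ∀ z, SmoothGermAt z 0 → SmoothGermAt (T z) 0 := fun z hz =>
    ((sv.smooth_inner sv).mul (hz.smooth_inner su)).sub
      ((su.smooth_inner sv).mul (hz.smooth_inner sv))
  have hD : SmoothGermAt D 0 :=
    ((su.smooth_inner su).mul (sv.smooth_inner sv)).sub ((su.smooth_inner sv).pow 2)
  have hκ : SmoothGermAt κ 0 := (smoothGermAt_const w 0).smooth_inner h.smooth.smooth_normalField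
  have hD0 : D 0 ≠ 0 := by
    simp only [D, gram_eq_norm_cross_sq]
    exact pow_ne_zero 2 (norm_ne_zero_iff.2 h.normal_ne)
  have hκ0 : κ 0 ≠ 0 := by
    intro hz
    have := norm_cross_sq_smul h.inner_du h.inner_dv
    change _ = κ 0 • _ at this
    rw [hz, zero_smul] at this
    exact (smul_ne_zero (pow_ne_zero 2 (norm_ne_zero_iff.2 h.normal_ne)) h.w_ne) this
  have hxc : ContDiff ℝ ∞ fun x : ℝ => (x, (0 : ℝ)) := by fun_prop
  have hxt : Tendsto (fun x : ℝ => (x, (0 : ℝ))) (𝓝 0) (𝓝 0) := hxc.continuous.tendsto' 0 0 rfl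
  have hx : ∀ z : ℝ × ℝ → ℝ, SmoothGermAt z 0 → SmoothGermAt (fun x => z (x, 0)) 0 := fun z hz =>
    hz.comp_of_eq (hxc.smoothGermAt 0) rfl
  have hψ' := h.smooth_fn.smooth_deriv
  let N : ℝ → ℝ := fun x => 2 * ε * D (x, 0) - deriv ψ x * T (dv (dv g)) (x, 0)
  have hN : SmoothGermAt N 0 := ((smoothGermAt_const (2 * ε) 0).mul (hx _ hD)).sub
    (hψ'.mul (hx _ (hT _ sv.smooth_dv)))
  have hN0 : N 0 = 2 * ε * D 0 := by simp [N, h.deriv_zero, ← Prod.zero_eq_mk]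
  refine ⟨fun x => κ (x, 0) ^ 2, fun x => D (x, 0) * N x,
    fun x => 0 - (T (du (du g)) (x, 0) * N x + deriv ψ x * T (dv (du g)) (x, 0) ^ 2),
    (hx _ hκ).pow 2, (hx _ hD).mul hN, (smoothGermAt_const 0 0).sub
      (((hx _ (hT _ su.smooth_du)).mul hN).add (hψ'.mul ((hx _ (hT _ su.smooth_dv)).pow 2))),
    pow_ne_zero 2 hκ0, mul_ne_zero hD0 ?_, ?_⟩
  · rw [hN0]
    exact mul_ne_zero (mul_ne_zero two_ne_zero h.sign) hD0
  · filter_upwards [hxt.eventually h.inner_first, hxt.eventually h.inner_second] with x h1 h2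
    obtain ⟨a1, a2⟩ := h1
    obtain ⟨b1, b2, b3⟩ := h2
    simp only [mul_zero] at a1 a2 b1 b2 b3
    have frame : ∀ z : E3, D (x, 0) * inner ℝ z w = κ (x, 0) * inner ℝ z (normalField g (x, 0)) +
        deriv ψ x * T (fun _ => z) (x, 0) := fun z => by
      have := inner_frame (du g (x, 0)) (dv g (x, 0)) z w
      rw [a1, a2, zero_mul, add_zero] at this
      exact this
    have f1 := frame (du (du g) (x, 0))
    have f2 := frame (dv (du g) (x, 0))
    have f3 := frame (dv (dv g) (x, 0))
    change _ = _ + deriv ψ x * T (du (du g)) (x, 0) at f1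
    change _ = _ + deriv ψ x * T (dv (du g)) (x, 0) at f2
    change _ = _ + deriv ψ x * T (dv (dv g)) (x, 0) at f3
    rw [b1] at f1
    rw [b2, mul_zero] at f2
    rw [b3] at f3
    simp only [parabolicFn, N]
    -- Solving `f1`, `f2`, `f3` for `κ` times the entries of the second fundamental form gives `κ² Σ
    -- = (D ψ'' - ψ' T_uu) N - (ψ' T_uv)²`.
    linear_combination (-(κ (x, 0) * inner ℝ (dv (dv g) (x, 0)) (normalField g (x, 0)))) * f1
      - (D (x, 0) * deriv (deriv ψ) x - deriv ψ x * T (du (du g)) (x, 0)) * f3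
      + (κ (x, 0) * inner ℝ (dv (du g) (x, 0)) (normalField g (x, 0))
        - deriv ψ x * T (dv (du g)) (x, 0)) * f2

theorem IsSplitSurface.deriv_deriv_zero (h : IsSplitSurface g w ε ψ) :
    deriv (deriv ψ) 0 = 0 := by
  obtain ⟨A, B, R, -, -, -, -, hB, heq⟩ := h.exists_parabolicFn_eq
  have := heq.self_of_nhds
  rw [← Prod.zero_eq_mk, h.parabolic, h.deriv_zero, mul_zero, mul_zero, add_zero] at this
  exact (mul_eq_zero.1 this.symm).resolve_left hB

theorem IsSplitSurface.isBigO_three (h : IsSplitSurface g w ε ψ) :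
    ψ =O[𝓝 0] fun x : ℝ => x ^ 3 := by
  refine h.smooth_fn.isBigO_pow_iff.2 fun i hi => ?_
  interval_cases i
  · simpa using h.fn_zero
  · simpa using h.deriv_zero
  · simpa [iteratedDeriv_succ] using h.deriv_deriv_zero

/-- Differentiating `A Σ = B ψ'' + R ψ'` at `0`, where `Σ`, `ψ'` and `ψ''` vanish, leaves `A(0)
Σ_u(0) = B(0) ψ'''(0)`. -/
theorem IsSplitSurface.isBigO_four_iff (h : IsSplitSurface g w ε ψ) :
    (ψ =O[𝓝 0] fun x : ℝ => x ^ 4) ↔ du (parabolicFn g) 0 = 0 := by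
  obtain ⟨A, B, R, sA, sB, sR, hA, hB, heq⟩ := h.exists_parabolicFn_eq
  have s1 := h.smooth_fn.smooth_deriv
  have d1 := (sA.differentiableAt.hasDerivAt).mul
    (hasDerivAt_du h.smooth.smooth_parabolicFn.differentiableAt)
  have d2 := ((sB.differentiableAt.hasDerivAt).mul s1.smooth_deriv.differentiableAt.hasDerivAt).add
    ((sR.differentiableAt.hasDerivAt).mul s1.differentiableAt.hasDerivAt)
  have d3 := d1.unique (d2.congr_of_eventuallyEq heq)
  have hp : parabolicFn g ((0 : ℝ), (0 : ℝ)) = 0 := h.parabolic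
  simp only [Prod.snd_zero, hp, h.deriv_zero, h.deriv_deriv_zero, mul_zero, zero_add,
    add_zero] at d3
  have h3 : iteratedDeriv 3 ψ 0 = deriv (deriv (deriv ψ)) 0 := by simp [iteratedDeriv_succ]
  constructor
  · intro hO
    have := h.smooth_fn.isBigO_pow_iff.1 hO 3 (by norm_num)
    rw [← h3, this, mul_zero] at d3
    exact (mul_eq_zero.1 d3).resolve_left hA
  · intro hz
    rw [hz, mul_zero, ← h3] at d3
    refine h.smooth_fn.isBigO_pow_iff.2 fun i hi => ?_
    rcases Nat.lt_succ_iff_lt_or_eq.1 hi with hi | rfl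
    · exact h.smooth_fn.isBigO_pow_iff.1 h.isBigO_three i hi
    · exact (mul_eq_zero.1 d3.symm).resolve_left hB

theorem IsSplitSurface.parabolicFn_isBigO (h : IsSplitSurface g w ε ψ) {k : ℕ}
    (hψ : ψ =O[𝓝 0] fun x : ℝ => x ^ (k + 2)) :
    (fun x => parabolicFn g (x, 0)) =O[𝓝 0] fun x : ℝ => x ^ k := by
  obtain ⟨A, B, R, sA, sB, sR, hA, hB, heq⟩ := h.exists_parabolicFn_eq
  have h1 := h.smooth_fn.deriv_isBigO hψ
  have h2 := h.smooth_fn.smooth_deriv.deriv_isBigO h1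
  have h1' : deriv ψ =O[𝓝 0] fun x : ℝ => x ^ k :=
    h1.trans (isBigO_pow_pow (by omega))
  have h3 : (fun x => A x * parabolicFn g (x, 0)) =O[𝓝 0] fun x : ℝ => x ^ k := by
    refine IsBigO.congr' ?_ (heq.mono fun x hx => hx.symm) EventuallyEq.rfl
    have e1 := (sB.continuousAt.tendsto.isBigO_one ℝ).mul h2
    have e2 := (sR.continuousAt.tendsto.isBigO_one ℝ).mul h1'
    simpa using e1.add e2
  have h4 := ((sA.continuousAt.inv₀ hA).tendsto.isBigO_one ℝ).mul h3
  simp only [one_mul] at h4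
  refine h4.congr' ?_ EventuallyEq.rfl
  filter_upwards [sA.continuousAt.eventually_ne hA] with x hx
  simp [hx]

/-! ### Curves in the parabolic set -/

/-- If the zero set of `f` is transverse to the second axis, the second coordinate of a curve in it
is controlled by the values of `f` on the first axis. -/
theorem snd_isBigO_of_dv_ne_zero {f : ℝ × ℝ → ℝ} (hf : SmoothGermAt f 0) (hfv : dv f 0 ≠ 0)
    {γ : ℝ → ℝ × ℝ} (hγ : Tendsto γ (𝓝 0) (𝓝 0)) (hz : ∀ᶠ t in 𝓝 (0 : ℝ), f (γ t) = 0) :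
    (fun t => (γ t).2) =O[𝓝 0] fun t => f ((γ t).1, 0) := by
  have hs : HasStrictFDerivAt f (fderiv ℝ f 0) 0 := hf.contDiffAt.hasStrictFDerivAt (by simp)
  have hproj : Tendsto (fun t => ((γ t).1, (0 : ℝ))) (𝓝 0) (𝓝 0) :=
    ((by fun_prop : Continuous fun p : ℝ × ℝ => (p.1, (0 : ℝ))).tendsto' 0 0 rfl).comp hγ
  have ht : Tendsto (fun t => (γ t, ((γ t).1, (0 : ℝ)))) (𝓝 0) (𝓝 (0, 0)) := by
    rw [nhds_prod_eq]; exact hγ.prodMk hproj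
  -- Strict differentiability compares `f` at `γ` and at its projection to the first axis; since `f
  -- ∘ γ = 0`, this gives `f(x, 0) + y f_v(0) = o(y)`.
  have h1 := hs.isLittleO.comp_tendsto ht
  have h2 : (fun t => -(f ((γ t).1, 0) + (γ t).2 * dv f 0)) =o[𝓝 0]
      fun t => (γ t).2 * dv f 0 := by
    have h3 : (fun t => γ t - ((γ t).1, (0 : ℝ))) =O[𝓝 0] fun t => (γ t).2 * dv f 0 := by
      refine IsBigO.of_bound ‖dv f 0‖⁻¹ (Eventually.of_forall fun t => ?_)
      have : γ t - ((γ t).1, (0 : ℝ)) = (0, (γ t).2) := by ext <;> simp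
      rw [this, norm_mul, mul_comm ‖(γ t).2‖, inv_mul_cancel_left₀ (norm_ne_zero_iff.2 hfv)]
      simp
    refine (h1.trans_isBigO h3).congr' ?_ EventuallyEq.rfl
    filter_upwards [hz] with t h0
    simp only [Function.comp]
    rw [h0, fderiv_apply_eq]
    simp
    ring
  have h4 := h2.right_isBigO_add
  have h5 : (fun t => (γ t).2 * dv f 0) =O[𝓝 0] fun t => f ((γ t).1, 0) := by
    refine h4.trans (IsBigO.of_bound 1 (Eventually.of_forall fun t => ?_))
    rw [one_mul, ← norm_neg]
    refine le_of_eq (congrArg _ ?_)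
    ring
  have h6 := h5.const_mul_left (dv f 0)⁻¹
  refine h6.congr_left fun t => ?_
  field_simp

theorem dv_ne_zero_of_du_eq_zero {f : ℝ × ℝ → ℝ} {p : ℝ × ℝ} (h : fderiv ℝ f p ≠ 0) (h1 : du f p = 0) :
    dv f p ≠ 0 := by
  intro h2
  refine h (ContinuousLinearMap.ext fun q => ?_)
  rw [fderiv_apply_eq, h1, h2]
  simp

variable {γ : ℝ → ℝ × ℝ}

/-- If `ψ` has order at least `k + 4`, so has the height function along the parabolic curve. -/
theorem IsSplitSurface.height_comp_isBigO (h : IsSplitSurface g w ε ψ) (hγ : SmoothGermAt γ 0)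
    (hγ0 : γ 0 = 0) (hz : ∀ᶠ t in 𝓝 (0 : ℝ), parabolicFn g (γ t) = 0) {k : ℕ}
    (hψ : ψ =O[𝓝 0] fun x : ℝ => x ^ (k + 4)) :
    (fun t => height g w (γ t)) =O[𝓝 0] fun t : ℝ => t ^ (k + 4) := by
  have hγt : Tendsto γ (𝓝 0) (𝓝 0) := by
    have := hγ.continuousAt.tendsto
    rwa [hγ0] at this
  have hx : Tendsto (fun t => (γ t).1) (𝓝 0) (𝓝 0) :=
    (continuous_fst.tendsto' (0 : ℝ × ℝ) 0 rfl).comp hγt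
  have hxO : (fun t => (γ t).1) =O[𝓝 0] fun t : ℝ => t := by
    have := (hγ.fst.isBigO_pow_iff (n := 1)).2 fun i hi => by
      obtain rfl : i = 0 := by omega
      simp [hγ0]
    simpa using this
  have h4 : du (parabolicFn g) 0 = 0 := h.isBigO_four_iff.1 (hψ.trans (isBigO_pow_pow (by omega)))
  have hy := snd_isBigO_of_dv_ne_zero h.smooth.smooth_parabolicFn (dv_ne_zero_of_du_eq_zero h.regular h4)
    hγt hz
  have hy2 : (fun t => (γ t).2) =O[𝓝 0] fun t : ℝ => t ^ (k + 2) :=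
    hy.trans (((h.parabolicFn_isBigO hψ).comp_tendsto hx).trans (hxO.pow (k + 2)))
  have hyy : (fun t => ε * (γ t).2 ^ 2) =O[𝓝 0] fun t : ℝ => t ^ (k + 4) := by
    refine ((hy2.pow 2).const_mul_left ε).trans ?_
    simp only [← pow_mul]
    -- Squaring gives order `2 (k + 2)`, which is at least `k + 4`.
    exact isBigO_pow_pow (by omega)
  refine (hyy.add ((hψ.comp_tendsto hx).trans (hxO.pow (k + 4)))).congr' ?_ EventuallyEq.rfl
  filter_upwards [hγt.eventually h.height_eq] with t ht
  exact ht.symm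

/-- If the height function has order at least three along the parabolic curve, then `ψ` has order
at least four. -/
theorem IsSplitSurface.isBigO_four (h : IsSplitSurface g w ε ψ) (hγ : SmoothGermAt γ 0)
    (hγ0 : γ 0 = 0) (hγ' : deriv γ 0 ≠ 0) (hz : ∀ᶠ t in 𝓝 (0 : ℝ), parabolicFn g (γ t) = 0)
    (hO : (fun t => height g w (γ t)) =O[𝓝 0] fun t : ℝ => t ^ 3) :
    ψ =O[𝓝 0] fun x : ℝ => x ^ 4 := by
  have hγt : Tendsto γ (𝓝 0) (𝓝 0) := by
    have := hγ.continuousAt.tendsto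
    rwa [hγ0] at this
  have hx : Tendsto (fun t => (γ t).1) (𝓝 0) (𝓝 0) :=
    (continuous_fst.tendsto' (0 : ℝ × ℝ) 0 rfl).comp hγt
  have hxO : (fun t => (γ t).1) =O[𝓝 0] fun t : ℝ => t := by
    have := (hγ.fst.isBigO_pow_iff (n := 1)).2 fun i hi => by
      obtain rfl : i = 0 := by omega
      simp [hγ0]
    simpa using this
  -- As `ψ` is always of order three, `ε y²` is a difference of two terms that are `O(t³)`. Its
  -- second derivative at `0` is then zero, and it equals `2 ε y'(0)²`.
  have hyy : (fun t => (γ t).2 ^ 2) =O[𝓝 0] fun t : ℝ => t ^ 3 := by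
    have h1 := (hO.sub ((h.isBigO_three.comp_tendsto hx).trans (hxO.pow 3))).const_mul_left ε⁻¹
    refine h1.congr' ?_ EventuallyEq.rfl
    filter_upwards [hγt.eventually h.height_eq] with t ht
    simp only [Function.comp, ht]
    have := h.sign
    field_simp
    ring
  have hy : deriv (fun t => (γ t).2) 0 = 0 := by
    have h1 := (hγ.snd.pow 2).isBigO_pow_iff.1 hyy 2 (by norm_num)
    have h2 : deriv (fun t => (γ t).2 ^ 2) =ᶠ[𝓝 0] fun t => 2 * (γ t).2 * deriv (fun t => (γ t).2) t := by
      filter_upwards [hγ.snd.eventually_differentiableAt] with t ht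
      simpa using (ht.hasDerivAt.fun_pow 2).deriv
    have h3 := ((hγ.snd.differentiableAt.hasDerivAt.const_mul 2).mul
      hγ.snd.smooth_deriv.differentiableAt.hasDerivAt).congr_of_eventuallyEq h2
    rw [iteratedDeriv_succ, iteratedDeriv_one, h3.deriv] at h1
    simpa [hγ0] using h1
  have hγd : HasDerivAt γ (deriv γ 0) 0 := hγ.differentiableAt.hasDerivAt
  have hγ2 : (deriv γ 0).2 = 0 := by
    refine Eq.trans ?_ hy
    exact ((hasFDerivAt_snd.comp_hasDerivAt (0 : ℝ) hγd).deriv).symm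
  have hγ1 : (deriv γ 0).1 ≠ 0 := fun h0 => hγ' (Prod.ext h0 hγ2)
  have hd : HasFDerivAt (parabolicFn g) (fderiv ℝ (parabolicFn g) 0) (γ 0) := by
    rw [hγ0]; exact h.smooth.smooth_parabolicFn.differentiableAt.hasFDerivAt
  -- Differentiating `Σ ∘ γ = 0` along the tangent `(x', 0)` with `x' ≠ 0` gives `Σ_u(0) = 0`.
  have hc := (hd.comp_hasDerivAt (0 : ℝ) hγd).unique
    ((hasDerivAt_const (0 : ℝ) (0 : ℝ)).congr_of_eventuallyEq hz)
  rw [fderiv_apply_eq, hγ2, zero_smul, add_zero, smul_eq_mul] at hc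
  exact h.isBigO_four_iff.2 ((mul_eq_zero.1 hc).resolve_left hγ1)

end SplitSurface

/-! ### Contact of a space curve with a plane -/

section Curve

variable {L : ℝ → E3} {w : E3}

theorem iteratedDeriv_inner_const (hL : SmoothGermAt L 0) (w : E3) (n : ℕ) :
    iteratedDeriv n (fun t => inner ℝ (L t) w) =ᶠ[𝓝 0] fun t => inner ℝ (iteratedDeriv n L t) w := by
  induction n with
  | zero => simp
  | succ n ih =>
    filter_upwards [ih.eventuallyEq_nhds, (hL.smooth_iteratedDeriv n).eventually_differentiableAt]
      with t h1 h2
    rw [iteratedDeriv_succ, iteratedDeriv_succ, h1.deriv_eq]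
    simpa using (h2.hasDerivAt.inner ℝ (hasDerivAt_const t w)).deriv

theorem inner_isBigO_pow_iff (hL : SmoothGermAt L 0) (w : E3) {n : ℕ} :
    ((fun t => (inner ℝ (L t) w : ℝ)) =O[𝓝 0] fun t : ℝ => t ^ n) ↔
      ∀ i < n, inner ℝ (iteratedDeriv i L 0) w = 0 := by
  rw [(hL.smooth_inner (smoothGermAt_const w 0)).isBigO_pow_iff]
  refine forall_congr' fun i => imp_congr_right fun _ => ?_
  rw [(iteratedDeriv_inner_const hL w i).self_of_nhds]

/-- Both `a × b` and `w` span the line orthogonal to `a` and `b`, so they have the same orthogonal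
plane. It makes the determinants in the torsion vanish. -/
theorem inner_cross_eq_zero {a b z : E3} (hab : cross a b ≠ 0) (hw : w ≠ 0) (ha : inner ℝ a w = 0)
    (hb : inner ℝ b w = 0) (hz : inner ℝ z w = 0) : inner ℝ (cross a b) z = 0 := by
  have h1 := norm_cross_sq_smul ha hb
  have h2 : inner ℝ w (cross a b) ≠ 0 := by
    intro h0
    rw [h0, zero_smul] at h1
    exact smul_ne_zero (pow_ne_zero 2 (norm_ne_zero_iff.2 hab)) hw h1
  have h3 := congrArg (fun v : E3 => inner ℝ v z) h1
  simp only [real_inner_smul_left] at h3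
  rw [real_inner_comm, hz, mul_zero] at h3
  exact (mul_eq_zero.1 h3.symm).resolve_left h2

/-- The osculating plane is orthogonal to `w` if and only if the contact with the plane orthogonal
to `w` has order at least three. -/
theorem binormal_eq_or_eq_neg_iff (hL : SmoothGermAt L 0) (hw : ‖w‖ = 1) (h0 : inner ℝ (L 0) w = 0)
    (h1 : inner ℝ (deriv L 0) w = 0) (hm : cross (deriv L 0) (iteratedDeriv 2 L 0) ≠ 0) :
    (binormal L 0 = w ∨ binormal L 0 = -w) ↔
      (fun t => (inner ℝ (L t) w : ℝ)) =O[𝓝 0] fun t : ℝ => t ^ 3 := by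
  rw [inner_isBigO_pow_iff hL]
  have h2 : (∀ i < 3, inner ℝ (iteratedDeriv i L 0) w = 0) ↔ inner ℝ (iteratedDeriv 2 L 0) w = 0 := by
    refine ⟨fun h => h 2 (by norm_num), fun h i hi => ?_⟩
    interval_cases i
    · simpa using h0
    · simpa using h1
    · exact h
  rw [h2]
  constructor
  · have h3 : inner ℝ (iteratedDeriv 2 L 0) (binormal L 0) = 0 := by
      rw [binormal, inner_smul_right, inner_cross_right, mul_zero]
    rintro (h | h)
    · rwa [h] at h3
    · rw [h, inner_neg_right] at h3
      exact neg_eq_zero.1 h3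
  · intro h
    exact eq_or_eq_neg_normalize_cross h1 h hw hm

theorem torsion_eq_zero (hL : SmoothGermAt L 0) (hw : w ≠ 0)
    (hm : cross (deriv L 0) (iteratedDeriv 2 L 0) ≠ 0)
    (hO : (fun t => (inner ℝ (L t) w : ℝ)) =O[𝓝 0] fun t : ℝ => t ^ 4) : torsion L 0 = 0 := by
  have h := (inner_isBigO_pow_iff hL w).1 hO
  have h1 := h 1 (by norm_num)
  rw [iteratedDeriv_one] at h1
  rw [torsion, inner_cross_eq_zero hm hw h1 (h 2 (by norm_num)) (h 3 (by norm_num)), zero_div]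

/-- The derivative of `det(L', L'', L''')` is `det(L', L'', L'''')`, and contact of order five puts
all four vectors in the plane orthogonal to `w`. Numerator and its derivative thus vanish at `0`. -/
theorem hasDerivAt_torsion_zero (hL : SmoothGermAt L 0) (hw : w ≠ 0)
    (hm : cross (deriv L 0) (iteratedDeriv 2 L 0) ≠ 0)
    (hO : (fun t => (inner ℝ (L t) w : ℝ)) =O[𝓝 0] fun t : ℝ => t ^ 5) :
    HasDerivAt (torsion L) 0 0 := by
  have h := (inner_isBigO_pow_iff hL w).1 hO
  have h1 := h 1 (by norm_num)
  rw [iteratedDeriv_one] at h1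
  have hd : ∀ n, HasDerivAt (iteratedDeriv n L) (iteratedDeriv (n + 1) L 0) 0 := fun n => by
    rw [iteratedDeriv_succ]; exact (hL.smooth_iteratedDeriv n).differentiableAt.hasDerivAt
  have hd1 : HasDerivAt (deriv L) (iteratedDeriv 2 L 0) 0 := by simpa using hd 1
  have hc := hd1.cross (hd 2)
  have hnum := hc.inner ℝ (hd 3)
  have hden : DifferentiableAt ℝ
      (fun t => ‖cross (deriv L t) (iteratedDeriv 2 L t)‖ ^ 2) 0 := hc.differentiableAt.norm_sq ℝ
  have hne : ‖cross (deriv L 0) (iteratedDeriv 2 L 0)‖ ^ 2 ≠ 0 :=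
    pow_ne_zero 2 (norm_ne_zero_iff.2 hm)
  refine (hnum.div hden.hasDerivAt hne).congr_deriv ?_
  have h3 : inner ℝ (cross (deriv L 0) (iteratedDeriv (2 + 1) L 0)) (iteratedDeriv 3 L 0) = 0 := by
    rw [real_inner_comm]; exact inner_cross_right _ _
  rw [inner_add_left, h3,
    inner_cross_eq_zero hm hw h1 (h 2 (by norm_num)) (h 4 (by norm_num)),
    inner_cross_eq_zero hm hw h1 (h 2 (by norm_num)) (h 3 (by norm_num))]
  have : inner ℝ (cross (iteratedDeriv 2 L 0) (iteratedDeriv 2 L 0)) (iteratedDeriv 3 L 0) = 0 := by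
    simp only [inner_E3, cross_zero_coord, cross_one_coord, cross_two_coord]; ring
  rw [this]
  simp

end Curve

/-! ### The height function along the normal at a parabolic point -/

theorem normalField_ne_zero {g : ℝ × ℝ → E3} {p : ℝ × ℝ}
    (h : Function.Injective (fderiv ℝ g p)) : normalField g p ≠ 0 := by
  intro h0
  have key : ∀ x y : ℝ, x • du g p + y • dv g p = 0 → x = 0 ∧ y = 0 := by
    intro x y hxy
    have h1 : fderiv ℝ g p (x, y) = fderiv ℝ g p 0 := by rw [fderiv_apply_eq, hxy, map_zero]
    simpa using h h1
  have hgram := gram_eq_norm_cross_sq (du g p) (dv g p)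
  change _ = ‖normalField g p‖ ^ 2 at hgram
  rw [h0, norm_zero] at hgram
  -- The vector `⟨g_v, g_v⟩ g_u - ⟨g_u, g_v⟩ g_v` has squared length `⟨g_v, g_v⟩` times the Gram
  -- determinant, which is zero here.
  have h1 := key (inner ℝ (dv g p) (dv g p)) (-inner ℝ (du g p) (dv g p)) (by
    rw [← inner_self_eq_zero (𝕜 := ℝ)]
    simp only [inner_add_left, inner_add_right, real_inner_smul_left, real_inner_smul_right]
    rw [real_inner_comm (du g p) (dv g p)]
    linear_combination inner ℝ (dv g p) (dv g p) * hgram)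
  have h2 : dv g p = 0 := inner_self_eq_zero.1 h1.1
  have h3 := key 0 1 (by simp [h2])
  exact one_ne_zero h3.2

section Height

variable {g : ℝ × ℝ → E3} {w : E3} {φ : ℝ × ℝ → ℝ × ℝ} {ε : ℝ} {ψ : ℝ → ℝ}

theorem IsSplitting.isSplitSurface (h : IsSplitting (height g w) φ ε ψ) (hg : SmoothGermAt g 0)
    (hg0 : g 0 = 0) (hν : normalField g 0 ≠ 0) (hw : w ≠ 0) (hu : inner ℝ (du g 0) w = 0)
    (hv : inner ℝ (dv g 0) w = 0) (hpar : parabolicFn g 0 = 0)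
    (hns : fderiv ℝ (parabolicFn g) 0 ≠ 0) : IsSplitSurface (fun p => g (φ p)) w ε ψ := by
  have hφ := h.diffeo
  have hg' : SmoothGermAt g (φ 0) := by rw [hφ.2.1]; exact hg
  have hd := hg'.differentiableAt
  have hφd := hφ.1.differentiableAt
  refine ⟨hg'.comp hφ.1, ?_, h.smooth, ?_, h.zero, hw, ?_, ?_, ?_, ?_,
    fderiv_parabolicFn_comp_ne_zero hg hφ hpar hns⟩
  · rw [normalField_comp hd hφd, hφ.2.1]
    exact smul_ne_zero (bijective_fderiv_iff.1 hφ.2.2) hν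
  · rcases h.sign with rfl | rfl <;> norm_num
  · rw [du_comp hd hφd, hφ.2.1]
    simp only [inner_add_left, real_inner_smul_left, hu, hv]; simp
  · rw [dv_comp hd hφd, hφ.2.1]
    simp only [inner_add_left, real_inner_smul_left, hu, hv]; simp
  · have h0 : height g w 0 = 0 := by simp [height, hg0]
    have := h.eq
    rw [h0] at this
    simp only [zero_add] at this
    exact this
  · rw [parabolicFn_comp hg' hφ.1, hφ.2.1, hpar, mul_zero]

/-- In a splitting of the height function along the normal, the order of the one-variable part is
related to the order of contact of the parabolic curve with the tangent plane. -/
theorem IsSplitting.contact (h : IsSplitting (height g w) φ ε ψ) (hg : SmoothGermAt g 0)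
    (hg0 : g 0 = 0) (hν : normalField g 0 ≠ 0) (hw : w ≠ 0) (hu : inner ℝ (du g 0) w = 0)
    (hv : inner ℝ (dv g 0) w = 0) (hpar : parabolicFn g 0 = 0)
    (hns : fderiv ℝ (parabolicFn g) 0 ≠ 0) {γ : ℝ → ℝ × ℝ} (hγ : SmoothGermAt γ 0)
    (hγ0 : γ 0 = 0) (hγ' : deriv γ 0 ≠ 0)
    (hz : ∀ᶠ t in 𝓝 (0 : ℝ), parabolicFn g (γ t) = 0) :
    (ψ =O[𝓝 0] fun x : ℝ => x ^ 3) ∧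
    (((fun t => height g w (γ t)) =O[𝓝 0] fun t : ℝ => t ^ 3) → ψ =O[𝓝 0] fun x : ℝ => x ^ 4) ∧
    ∀ k : ℕ, (ψ =O[𝓝 0] fun x : ℝ => x ^ (k + 4)) →
      (fun t => height g w (γ t)) =O[𝓝 0] fun t : ℝ => t ^ (k + 4) := by
  have hS := h.isSplitSurface hg hg0 hν hw hu hv hpar hns
  have hφ := h.diffeo
  obtain ⟨χ, hχ, -, hφχ⟩ := hφ.exists_inverse
  have hγt : Tendsto γ (𝓝 0) (𝓝 0) := by
    have := hγ.continuousAt.tendsto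
    rwa [hγ0] at this
  -- The parabolic curve read in the splitting coordinates.
  let η : ℝ → ℝ × ℝ := fun t => χ (γ t)
  have hη : SmoothGermAt η 0 := hχ.1.comp_of_eq hγ hγ0
  have hη0 : η 0 = 0 := by simp only [η, hγ0, hχ.2.1]
  have hη' : deriv η 0 ≠ 0 := by
    have hd : HasFDerivAt χ (fderiv ℝ χ 0) (γ 0) := by
      rw [hγ0]; exact hχ.1.differentiableAt.hasFDerivAt
    have h1 := (hd.comp_hasDerivAt (0 : ℝ) hγ.differentiableAt.hasDerivAt).deriv
    change deriv η 0 = _ at h1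
    rw [h1]
    exact fun h2 => hγ' (hχ.2.2.1 (h2.trans (map_zero _).symm))
  have hφη : ∀ᶠ t in 𝓝 (0 : ℝ), φ (η t) = γ t := hγt.eventually hφχ
  have hηz : ∀ᶠ t in 𝓝 (0 : ℝ), parabolicFn (fun p => g (φ p)) (η t) = 0 := by
    have hηt : Tendsto η (𝓝 0) (𝓝 0) := hχ.tendsto.comp hγt
    filter_upwards [hz, hφη, hηt.eventually (eventually_eventually_nhds.2 hφ.1),
      hγt.eventually (eventually_eventually_nhds.2 hg)] with t h1 h2 h3 h4
    rw [parabolicFn_comp (by rw [h2]; exact h4) h3, h2, h1, mul_zero]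
  have hheight : (fun t => height (fun p => g (φ p)) w (η t)) =ᶠ[𝓝 0] fun t => height g w (γ t) := by
    filter_upwards [hφη] with t h1
    simp only [height, h1]
  refine ⟨hS.isBigO_three, fun hO => ?_, fun k hO => ?_⟩
  · exact hS.isBigO_four hη hη0 hη' hηz (hO.congr' hheight.symm EventuallyEq.rfl)
  · exact (hS.height_comp_isBigO hη hη0 hηz hO).congr' hheight EventuallyEq.rfl

/-- At a non-umbilic point, the height function along the normal admits a splitting. -/
theorem exists_isSplitting_height (hg : SmoothGermAt g 0) (humb : ¬ IsUmbilic g 0)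
    (hw : w = unitNormal g 0 ∨ w = -unitNormal g 0) (hu : inner ℝ (du g 0) w = 0)
    (hv : inner ℝ (dv g 0) w = 0) : ∃ φ ε ψ, IsSplitting (height g w) φ ε ψ := by
  have e1 : du (height g w) =ᶠ[𝓝 0] fun p => inner ℝ (du g p) w :=
    hg.eventually_differentiableAt.mono fun p hp => du_inner_const w hp
  have e2 : dv (height g w) =ᶠ[𝓝 0] fun p => inner ℝ (dv g p) w :=
    hg.eventually_differentiableAt.mono fun p hp => dv_inner_const w hp
  refine exists_isSplitting (hg.smooth_inner (smoothGermAt_const w 0))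
    (e1.self_of_nhds.trans hu) (e2.self_of_nhds.trans hv) ?_
  rw [du_congr e1, dv_congr e1, dv_congr e2, du_inner_const w hg.smooth_du.differentiableAt,
    dv_inner_const w hg.smooth_du.differentiableAt, dv_inner_const w hg.smooth_dv.differentiableAt]
  rintro ⟨h1, h2, h3⟩
  have hn : ∀ z : E3, inner ℝ z w = 0 → inner ℝ z (unitNormal g 0) = 0 := by
    intro z hz
    rcases hw with rfl | rfl
    · exact hz
    · rwa [inner_neg_right, neg_eq_zero] at hz
  -- A vanishing Hessian would make the point a flat umbilic, with factor `0`.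
  exact humb ⟨0, by simp [hn _ h1], by simp [hn _ h2], by simp [hn _ h3]⟩

end Height

theorem not_isBigO_pow_succ {δ : ℝ} (hδ : δ ≠ 0) (k : ℕ) :
    ¬ (fun x : ℝ => δ * x ^ k) =O[𝓝 0] fun x : ℝ => x ^ (k + 1) := by
  intro h
  obtain ⟨r, hr, heq⟩ := ((by fun_prop : ContDiff ℝ ∞ fun x : ℝ => δ * x ^ k).smoothGermAt 0
    ).exists_eq_pow_mul _ h
  have h1 : ∀ᶠ x in 𝓝[≠] (0 : ℝ), δ = x * r x := by
    filter_upwards [nhdsWithin_le_nhds heq, self_mem_nhdsWithin] with x hx hx0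
    have h2 : x ^ k ≠ 0 := pow_ne_zero k hx0
    refine mul_right_cancel₀ h2 (hx.trans ?_)
    ring
  have h3 : Tendsto (fun x => x * r x) (𝓝[≠] (0 : ℝ)) (𝓝 0) := by
    have := (ContinuousAt.fun_mul continuousAt_id hr.continuousAt).tendsto.mono_left
      (nhdsWithin_le_nhds (a := (0 : ℝ)) (s := {0}ᶜ))
    simpa using this
  exact hδ (tendsto_nhds_unique (tendsto_const_nhds.congr' h1) h3)

end HeightSing

/-! ### Assembling the three statements -/

theorem proposition4p2
    (g : ℝ × ℝ → HeightSing.E3)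
    (hg : HeightSing.SmoothGermAt g 0) (hg0 : g 0 = 0)
    -- the surface is regular at the origin, which is a parabolic point but not an umbilic
    (hreg : Function.Injective (fderiv ℝ g 0))
    (hpar : HeightSing.parabolicFn g 0 = 0)
    (humb : ¬ HeightSing.IsUmbilic g 0)
    -- the parabolic set in the parameter space is not singular at the origin
    (hns : fderiv ℝ (HeightSing.parabolicFn g) 0 ≠ 0)
    -- a regular parameterization of the parabolic set near the origin
    (γ : ℝ → ℝ × ℝ)
    (hγ : HeightSing.SmoothGermAt γ 0) (hγ0 : γ 0 = 0) (hγ' : deriv γ 0 ≠ 0)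
    (hγpar : ∀ᶠ t in 𝓝 (0 : ℝ), HeightSing.parabolicFn g (γ t) = 0)
    -- the corresponding curve on the surface
    (L : ℝ → HeightSing.E3) (hL : L = g ∘ γ)
    (hκ : HeightSing.curvature L 0 ≠ 0)
    -- the normal direction
    (w : HeightSing.E3)
    (hw : w = HeightSing.unitNormal g 0 ∨ w = -HeightSing.unitNormal g 0) :
    (HeightSing.IsA 2 (HeightSing.height g w) ↔
      ¬ (HeightSing.binormal L 0 = HeightSing.unitNormal g 0 ∨
         HeightSing.binormal L 0 = -HeightSing.unitNormal g 0)) ∧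
    (HeightSing.IsAGe 3 (HeightSing.height g w) ↔
      (HeightSing.binormal L 0 = HeightSing.unitNormal g 0 ∨
       HeightSing.binormal L 0 = -HeightSing.unitNormal g 0)) ∧
    (HeightSing.IsAGe 3 (HeightSing.height g w) → HeightSing.torsion L 0 = 0) ∧
    (HeightSing.IsAGe 3 (HeightSing.height g w) →
      (deriv (HeightSing.torsion L) 0 ≠ 0 → HeightSing.IsA 3 (HeightSing.height g w)) ∧
      (HeightSing.IsAGe 4 (HeightSing.height g w) →
        HasDerivAt (HeightSing.torsion L) 0 0)) := by
  open HeightSing Asymptotics in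
  have hν := normalField_ne_zero hreg
  have hn1 : ‖unitNormal g 0‖ = 1 := by
    rw [unitNormal, norm_smul, norm_inv, norm_norm, inv_mul_cancel₀ (norm_ne_zero_iff.2 hν)]
  have hw1 : ‖w‖ = 1 := by rcases hw with rfl | rfl <;> simp [hn1]
  have hw0 : w ≠ 0 := fun h => by simp [h] at hw1
  have horth : ∀ a : E3, inner ℝ a (normalField g 0) = 0 → inner ℝ a w = 0 := by
    intro a ha
    rcases hw with rfl | rfl <;> simp [unitNormal, inner_smul_right, ha]
  have hu : inner ℝ (du g 0) w = 0 := horth _ (inner_cross_left _ _)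
  have hv : inner ℝ (dv g 0) w = 0 := horth _ (inner_cross_right _ _)
  have hLs : SmoothGermAt L 0 := by rw [hL]; exact hg.comp_of_eq hγ hγ0
  have hL0 : inner ℝ (L 0) w = 0 := by simp [hL, hγ0, hg0]
  have hL1 : inner ℝ (deriv L 0) w = 0 := by
    have hd : HasFDerivAt g (fderiv ℝ g 0) (γ 0) := by
      rw [hγ0]; exact hg.differentiableAt.hasFDerivAt
    rw [hL, (hd.comp_hasDerivAt (0 : ℝ) hγ.differentiableAt.hasDerivAt).deriv, fderiv_apply_eq]
    simp only [inner_add_left, real_inner_smul_left, hu, hv]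
    simp
  have hm : cross (deriv L 0) (iteratedDeriv 2 L 0) ≠ 0 := fun h => hκ (by simp [curvature, h])
  have hheight : (fun t => height g w (γ t)) = fun t => inner ℝ (L t) w := by rw [hL]; rfl
  have hb : (binormal L 0 = unitNormal g 0 ∨ binormal L 0 = -unitNormal g 0) ↔
      (fun t => height g w (γ t)) =O[𝓝 0] fun t : ℝ => t ^ 3 := by
    rw [hheight, ← binormal_eq_or_eq_neg_iff hLs hw1 hL0 hL1 hm]
    rcases hw with rfl | rfl
    · rfl
    · rw [neg_neg, or_comm]
  -- Kept for every splitting, because the coordinates supplied by an `A_k` hypothesis need not be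
  -- those built below.
  have hcon : ∀ {φ ε ψ}, IsSplitting (height g w) φ ε ψ → _ := fun h =>
    h.contact hg hg0 hν hw0 hu hv hpar hns hγ hγ0 hγ' hγpar
  obtain ⟨φ, ε, ψ, hs⟩ := exists_isSplitting_height hg humb hw hu hv
  have hfour : ∀ {φ ε ψ}, IsSplitting (height g w) φ ε ψ →
      (ψ =O[𝓝 0] fun x : ℝ => x ^ 4) →
      (fun t => height g w (γ t)) =O[𝓝 0] fun t : ℝ => t ^ 3 := fun h hO =>
    ((hcon h).2.2 0 hO).trans (isBigO_pow_pow (by norm_num))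
  refine ⟨⟨fun hA hbn => ?_, fun hbn => ?_⟩, ⟨fun hA => ?_, fun hbn => ?_⟩, fun hA => ?_,
    fun hA => ⟨fun hτ => ?_, fun hA4 => ?_⟩⟩
  · obtain ⟨φ', ε', δ, hδ, hs'⟩ := hA.exists_isSplitting
    have hδ0 : δ ≠ 0 := by rcases hδ with rfl | rfl <;> norm_num
    -- If the binormal were normal to the surface, the cubic `δ x³` of the `A_2` form would have to
    -- be `O(x⁴)`.
    exact not_isBigO_pow_succ hδ0 3 ((hcon hs').2.1 (hb.1 hbn))
  · exact hs.isA (hcon hs).1 fun hO => hbn (hb.2 (hfour hs hO))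
  · obtain ⟨φ', ε', ψ', hs', hO⟩ := isAGe_iff.1 hA
    exact hb.2 (hfour hs' hO)
  · exact isAGe_iff.2 ⟨φ, ε, ψ, hs, (hcon hs).2.1 (hb.1 hbn)⟩
  · obtain ⟨φ', ε', ψ', hs', hO⟩ := isAGe_iff.1 hA
    exact torsion_eq_zero hLs hw0 hm (hheight ▸ (hcon hs').2.2 0 hO)
  · obtain ⟨φ', ε', ψ', hs', hO⟩ := isAGe_iff.1 hA
    -- Either `ψ` has order exactly four, which is `A_3`, or it is `O(x⁵)` and then the torsion has
    -- zero derivative.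
    refine hs'.isA hO fun hO5 => hτ ?_
    exact (hasDerivAt_torsion_zero hLs hw0 hm (hheight ▸ (hcon hs').2.2 1 hO5)).deriv
  · obtain ⟨φ', ε', ψ', hs', hO⟩ := isAGe_iff.1 hA4
    exact hasDerivAt_torsion_zero hLs hw0 hm (hheight ▸ (hcon hs').2.2 1 hO)
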